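/- Let $B$ be a (not necessarily commutative) ring with $1$ of prime characteristic $p$, let $D$ be a derivation of $B$ (an additive map with $D(\alpha\beta)=D(\alpha)\beta+\alpha D(\beta)$), and let $B[X;D]$ be the skew polynomial ring, whose elements are written uniquely as $\sum_i X^i c_i$ with $c_i\in B$ and whose multiplication is determined by $\alpha X=X\alpha+D(\alpha)$ for $\alpha\in B$. Let $$f=\sum_{j=0}^{e}X^{p^j}b_{j+1}+b_0\qquad(b_{e+1}=1)$$ be a monic $p$-polynomial with coefficients in $B$ such that $fB[X;D]=B[X;D]f$. Put $A=B[X;D]/fB[X;D]$, a ring extension of $B$, and $x=X+fB[X;D]$. Let $\tilde D$ be the derivation of $A$ induced by $D$, $\tilde D(\sum_j x^jc_j)=\sum_j x^jD(c_j)$; let $V=\{v\in A\mid \alpha v=v\alpha \text{ for all }\alpha\in B\}$ be the centralizer of $B$ in $A$, and let $V^{\tilde D}=\{v\in V\mid \tilde D(v)=0\}$, a subring of $A$. We say that $f$ is separable in $B[X;D]$ if the multiplication map $A\otimes_BA\to A$ splits as a homomorphism of $A$-$A$-bimodules, and weakly separable if every $B$-derivation $\delta:A\to A$ (a derivation with $\delta(B)=0$)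 is inner, i.e. of the form $\delta(y)=my-ym$ for a fixed $m\in A$. Then $\tilde D$ maps $V$ to $V$, the formula $$\tau(h)=\sum_{j=0}^{e}\tilde D^{\,p^j-1}(h)\,b_{j+1}$$ defines a map $\tau:V\to V^{\tilde D}$, the inclusion $\mathrm{inj}:V^{\tilde D}\to V$, $\tilde D:V\to V$ and $\tau:V\to V^{\tilde D}$ are homomorphisms of $V^{\tilde D}$-$V^{\tilde D}$-bimodules, and: (1) $f$ is weakly separable in $B[X;D]$ if and only if the sequence $$0\longrightarrow V^{\tilde D}\overset{\mathrm{inj}}{\longrightarrow}V\overset{\tilde D}{\longrightarrow}V\overset{\tau}{\longrightarrow}V^{\tilde D}$$ is exact. (2) $f$ is separable in $B[X;D]$ if and only if the sequence $$0\longrightarrow V^{\tilde D}\overset{\mathrm{inj}}{\longrightarrow}V\overset{\tilde D}{\longrightarrow}V\overset{\tau}{\longrightarrow}V^{\tilde D}\longrightarrow 0$$ is exact. -/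

import Mathlib

open scoped TensorProduct

/-- A derivation of a (not necessarily commutative) ring `R`: an additive endomorphism with
`D (a * b) = D a * b + a * D b`. -/
structure RingDerivation (R : Type*) [Ring R] extends R →+ R where
  leibniz' : ∀ a b : R, toFun (a * b) = toFun a * b + a * toFun b

namespace RingDerivation

variable {R : Type*} [Ring R]

instance : FunLike (RingDerivation R) R R where
  coe D := D.toFun
  coe_injective D E h := by
    rcases D with ⟨D, _⟩
    rcases E with ⟨E, _⟩
    have : D = E := DFunLike.coe_injective h
    subst this
    rfl

instance : AddMonoidHomClass (RingDerivation R) R R where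
  map_add D := D.map_add'
  map_zero D := D.map_zero'

theorem leibniz (D : RingDerivation R) (a b : R) : D (a * b) = D a * b + a * D b :=
  D.leibniz' a b

theorem map_one_eq_zero (D : RingDerivation R) : D 1 = 0 := by
  have h := D.leibniz 1 1
  simpa using h

end RingDerivation

/-! ### The skew polynomial ring `B[X;D]` -/

/-- The skew polynomial ring `B[X;D]`, in which `a X = X a + D a`. An element `g` stands for the
polynomial `∑ i, X ^ i * g i`, with its coefficients `g i` written on the right. -/
def DiffPoly {B : Type*} [Ring B] (_D : RingDerivation B) : Type _ := ℕ →₀ B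

namespace DiffPoly

variable {B : Type*} [Ring B] {D : RingDerivation B}

noncomputable instance : AddCommGroup (DiffPoly D) :=
  inferInstanceAs (AddCommGroup (ℕ →₀ B))

/-- The coefficient of `X ^ n`. -/
def coeff (g : DiffPoly D) (n : ℕ) : B := (show ℕ →₀ B from g) n

/-- The monomial `X ^ i * a`, additively in `a`. -/
noncomputable def monomial (i : ℕ) : B →+ DiffPoly D := Finsupp.singleAddHom i

/-- An additive map out of `B[X;D]` given by its values on the monomials `X ^ i * a`. -/
noncomputable def lift {M : Type*} [AddCommGroup M] (F : ℕ → B →+ M) : DiffPoly D →+ M :=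
  Finsupp.liftAddHom F

theorem lift_monomial {M : Type*} [AddCommGroup M] (F : ℕ → B →+ M) (i : ℕ) (a : B) :
    lift F (monomial (D := D) i a) = F i a :=
  Finsupp.liftAddHom_apply_single F i a

theorem hom_ext {M : Type*} [AddCommGroup M] {F G : DiffPoly D →+ M}
    (h : ∀ i a, F (monomial i a) = G (monomial i a)) : F = G :=
  Finsupp.addHom_ext h

/-- The biadditive product of `B[X;D]`; on monomials it is
`(X ^ i * a) * (X ^ j * b) = ∑ k ≤ j, X ^ (i + k) * (j.choose k • (D ^ (j - k)) a * b)`. -/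
noncomputable def mulHom : DiffPoly D →+ DiffPoly D →+ DiffPoly D :=
  lift fun i =>
    { toFun := fun a => lift fun j =>
        { toFun := fun b => ∑ k ∈ Finset.range (j + 1),
            monomial (i + k) (j.choose k • (D^[j - k] a * b))
          map_zero' := by simp
          map_add' := fun b c => by simp [mul_add, Finset.sum_add_distrib] }
      map_zero' := hom_ext fun j b => by
        simp [lift_monomial, iterate_map_zero]
      map_add' := fun a c => hom_ext fun j b => by
        simp [lift_monomial, iterate_map_add, add_mul, Finset.sum_add_distrib] }

noncomputable instance : Mul (DiffPoly D) := ⟨fun f g => mulHom f g⟩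

noncomputable instance : One (DiffPoly D) := ⟨monomial 0 1⟩

theorem mul_def (f g : DiffPoly D) : f * g = mulHom f g := rfl

theorem one_def : (1 : DiffPoly D) = monomial 0 1 := rfl

theorem monomial_mul_monomial (i j : ℕ) (a b : B) :
    (monomial i a * monomial j b : DiffPoly D) =
      ∑ k ∈ Finset.range (j + 1), monomial (i + k) (j.choose k • (D^[j - k] a * b)) := by
  simp [mul_def, mulHom, lift_monomial]

/-- `g ↦ X * g`. -/
noncomputable def shift : DiffPoly D →+ DiffPoly D := lift fun i => monomial (i + 1)

theorem shift_monomial (i : ℕ) (a : B) :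
    shift (monomial i a : DiffPoly D) = monomial (i + 1) a := by
  simp [shift, lift_monomial]

theorem shift_mul (g h : DiffPoly D) : mulHom (shift g) h = shift (mulHom g h) := by
  have : (mulHom.comp shift : DiffPoly D →+ DiffPoly D →+ DiffPoly D) =
      (AddMonoidHom.compHom shift).comp mulHom := by
    refine hom_ext fun i a => hom_ext fun j b => ?_
    have h1 := monomial_mul_monomial (D := D) (i + 1) j a b
    have h2 := monomial_mul_monomial (D := D) i j a b
    rw [mul_def] at h1 h2
    simp only [AddMonoidHom.comp_apply, AddMonoidHom.compHom_apply_apply, shift_monomial, h1, h2,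
      map_sum]
    refine Finset.sum_congr rfl fun k _ => ?_
    rw [add_right_comm]
  exact DFunLike.congr_fun (DFunLike.congr_fun this g) h

theorem const_mul_shift (a : B) (g : DiffPoly D) :
    mulHom (monomial 0 a) (shift g) =
      shift (mulHom (monomial 0 a) g) + mulHom (monomial 0 (D a)) g := by
  have : (mulHom (monomial 0 a)).comp shift =
      (shift.comp (mulHom (monomial 0 a)) + mulHom (monomial 0 (D a)) :
        DiffPoly D →+ DiffPoly D) := by
    refine hom_ext fun j b => ?_
    have h1 := monomial_mul_monomial (D := D) 0 (j + 1) a b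
    have h2 := monomial_mul_monomial (D := D) 0 j a b
    have h3 := monomial_mul_monomial (D := D) 0 j (D a) b
    rw [mul_def] at h1 h2 h3
    simp only [AddMonoidHom.comp_apply, AddMonoidHom.add_apply, shift_monomial, h1, h2, h3,
      map_sum, zero_add]
    rw [Finset.sum_range_succ', Finset.sum_range_succ' (fun k => monomial (D := D) k _) j]
    have e1 : ∀ k ∈ Finset.range (j + 1),
        (monomial (k + 1) ((j + 1).choose (k + 1) • (D^[j + 1 - (k + 1)] a * b)) : DiffPoly D) =
          monomial (k + 1) (j.choose k • (D^[j - k] a * b)) +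
          monomial (k + 1) (j.choose (k + 1) • (D^[j - k] a * b)) := by
      intro k _
      rw [Nat.choose_succ_succ, add_smul, map_add, Nat.add_sub_add_right]
    rw [Finset.sum_congr rfl e1, Finset.sum_add_distrib, add_assoc]
    congr 1
    rw [Finset.sum_range_succ, Nat.choose_succ_self, zero_smul, map_zero, add_zero]
    congr 1
    swap
    · simp only [Nat.choose_zero_right, Nat.sub_zero, Function.iterate_succ_apply]
    refine Finset.sum_congr rfl fun k hk => ?_
    have hk' : j - k = (j - (k + 1)) + 1 := by
      have := Finset.mem_range.1 hk
      omega
    rw [hk', Function.iterate_succ_apply]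
  exact DFunLike.congr_fun this g

theorem ind {P : DiffPoly D → Prop} (h0 : ∀ a, P (monomial 0 a))
    (hS : ∀ g, P g → P (shift g)) (hadd : ∀ g h, P g → P h → P (g + h)) (g : DiffPoly D) :
    P g := by
  have hm : ∀ i a, P (monomial i a) := by
    intro i
    induction i with
    | zero => exact h0
    | succ i ih =>
      intro a
      rw [← shift_monomial]
      exact hS _ (ih a)
  refine Finsupp.induction_linear (motive := P) g ?_ (fun f g hf hg => hadd f g hf hg)
    (fun i a => hm i a)
  have := h0 0
  rwa [map_zero] at this

theorem const_mul_const (a b : B) (g : DiffPoly D) :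
    mulHom (monomial 0 a) (mulHom (monomial 0 b) g) = mulHom (monomial 0 (a * b)) g := by
  induction g using ind generalizing a b with
  | h0 c =>
    have h (x y : B) := monomial_mul_monomial (D := D) 0 0 x y
    simp only [mul_def] at h
    simp [h, mul_assoc]
  | hS g ih =>
    simp only [const_mul_shift, map_add, ih, D.leibniz, AddMonoidHom.add_apply]
    abel
  | hadd g h hg hh => simp only [map_add, hg, hh]

theorem const_mul_assoc (a : B) (g h : DiffPoly D) :
    mulHom (mulHom (monomial 0 a) g) h = mulHom (monomial 0 a) (mulHom g h) := by
  induction g using ind generalizing a with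
  | h0 b =>
    rw [const_mul_const]
    have h := monomial_mul_monomial (D := D) 0 0 a b
    rw [mul_def] at h
    simp [h]
  | hS g ih => simp only [const_mul_shift, shift_mul, map_add, AddMonoidHom.add_apply, ih]
  | hadd g h hg hh => simp only [map_add, AddMonoidHom.add_apply, hg, hh]

theorem mulHom_assoc (f g h : DiffPoly D) :
    mulHom (mulHom f g) h = mulHom f (mulHom g h) := by
  induction f using ind with
  | h0 a => exact const_mul_assoc a g h
  | hS f ih => simp only [shift_mul, ih]
  | hadd f g hf hg => simp only [map_add, AddMonoidHom.add_apply, hf, hg]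

theorem mulHom_one_left (g : DiffPoly D) : mulHom (monomial 0 1) g = g := by
  induction g using ind with
  | h0 a =>
    have h := monomial_mul_monomial (D := D) 0 0 1 a
    rw [mul_def] at h
    simp [h]
  | hS g ih =>
    simp only [const_mul_shift, ih, D.map_one_eq_zero, map_zero, AddMonoidHom.zero_apply, add_zero]
  | hadd f g hf hg => simp only [map_add, hf, hg]

theorem mulHom_one_right (g : DiffPoly D) : mulHom g (monomial 0 1) = g := by
  induction g using ind with
  | h0 a =>
    have h := monomial_mul_monomial (D := D) 0 0 a 1
    rw [mul_def] at h
    simp [h]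
  | hS g ih => simp only [shift_mul, ih]
  | hadd f g hf hg => simp only [map_add, AddMonoidHom.add_apply, hf, hg]

noncomputable instance : Ring (DiffPoly D) :=
  { (inferInstance : AddCommGroup (DiffPoly D)) with
    mul := fun f g => f * g
    one := 1
    mul_assoc := mulHom_assoc
    one_mul := mulHom_one_left
    mul_one := mulHom_one_right
    left_distrib := fun f g h => map_add (mulHom f) g h
    right_distrib := fun f g h => by
      change mulHom (f + g) h = mulHom f h + mulHom g h
      rw [map_add, AddMonoidHom.add_apply]
    zero_mul := fun f => by
      change mulHom 0 f = 0
      rw [map_zero, AddMonoidHom.zero_apply]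
    mul_zero := fun f => map_zero (mulHom f) }

/-- The inclusion of `B` into `B[X;D]` as the constant polynomials. -/
noncomputable def C : B →+* DiffPoly D :=
  { (monomial 0 : B →+ DiffPoly D) with
    map_one' := rfl
    map_mul' := fun a b => by
      change (monomial 0 (a * b) : DiffPoly D) = monomial 0 a * monomial 0 b
      simp [monomial_mul_monomial] }

/-- The indeterminate. -/
noncomputable def X : DiffPoly D := monomial 1 1

theorem C_mul_X (a : B) : (C a * X : DiffPoly D) = X * C a + C (D a) := by
  change (monomial 0 a * monomial 1 1 : DiffPoly D) = monomial 1 1 * monomial 0 a + monomial 0 (D a)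
  simp [monomial_mul_monomial, Finset.sum_range_succ, add_comm]

theorem X_pow_mul_C (i : ℕ) (a : B) : (X ^ i * C a : DiffPoly D) = monomial i a := by
  induction i with
  | zero => rw [pow_zero, one_mul]; rfl
  | succ i ih =>
    rw [pow_succ', mul_assoc, ih]
    change (monomial 1 1 * monomial i a : DiffPoly D) = _
    have h1 : (monomial 1 1 : DiffPoly D) = shift (monomial 0 1) := by rw [shift_monomial]
    rw [h1, mul_def, shift_mul, mulHom_one_left, shift_monomial]

/-- `D` acting on the coefficients: `∑ X ^ i * c i ↦ ∑ X ^ i * D (c i)`. -/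
noncomputable def mapCoeff : DiffPoly D →+ DiffPoly D :=
  lift fun i => (monomial i).comp D.toAddMonoidHom

theorem mapCoeff_monomial (i : ℕ) (a : B) :
    mapCoeff (monomial i a : DiffPoly D) = monomial i (D a) := by
  rw [mapCoeff, lift_monomial]
  rfl

theorem mapCoeff_eq (g : DiffPoly D) : mapCoeff g = g * X - X * g := by
  have : (mapCoeff : DiffPoly D →+ DiffPoly D) =
      AddMonoidHom.mulRight X - AddMonoidHom.mulLeft X := by
    refine hom_ext fun i a => ?_
    rw [mapCoeff_monomial]
    change _ = monomial i a * X - X * monomial i a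
    rw [← X_pow_mul_C, ← X_pow_mul_C, mul_assoc, C_mul_X, ← mul_assoc X,
      ← pow_succ', mul_add, ← mul_assoc, ← pow_succ]
    abel
  rw [this]
  rfl

/-- A polynomial is monic if its leading coefficient is `1`. -/
def Monic (g : DiffPoly D) : Prop :=
  ∃ n, g.coeff n = 1 ∧ ∀ m, n < m → g.coeff m = 0

variable (D) in
/-- The set `B[X;D]_(0)` of the monic polynomials `g` with `g B[X;D] = B[X;D] g`. -/
def invariantMonics : Set (DiffPoly D) :=
  {g | Monic g ∧ {h : DiffPoly D | ∃ q, h = g * q} = {h : DiffPoly D | ∃ q, h = q * g}}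

end DiffPoly

/-! ### The residue ring `A = B[X;D] / f B[X;D]` -/

namespace DiffPoly

variable {B : Type*} [Ring B] {D : RingDerivation B}

/-- The ideal `f B[X;D]`, for `f` in `B[X;D]_(0)`. -/
def idealOf (f : invariantMonics D) : Ideal (DiffPoly D) where
  carrier := {h | ∃ q, h = (f : DiffPoly D) * q}
  add_mem' := by
    rintro _ _ ⟨q, rfl⟩ ⟨r, rfl⟩
    exact ⟨q + r, (mul_add _ _ _).symm⟩
  zero_mem' := ⟨0, (mul_zero _).symm⟩
  smul_mem' := by
    intro c h hh
    have hh' : h ∈ {h : DiffPoly D | ∃ q, h = q * (f : DiffPoly D)} := f.2.2 ▸ hh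
    obtain ⟨q, rfl⟩ := hh'
    have : c * (q * (f : DiffPoly D)) ∈ {h : DiffPoly D | ∃ q, h = q * (f : DiffPoly D)} :=
      ⟨c * q, (mul_assoc _ _ _).symm⟩
    rwa [← f.2.2] at this

theorem mem_idealOf {f : invariantMonics D} {h : DiffPoly D} :
    h ∈ idealOf f ↔ ∃ q, h = (f : DiffPoly D) * q := Iff.rfl

instance (f : invariantMonics D) : (idealOf f).IsTwoSided where
  mul_mem_of_left := by
    rintro _ c ⟨q, rfl⟩
    exact ⟨q * c, mul_assoc _ _ _⟩

/-- The residue ring `A = B[X;D] / f B[X;D]`. -/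
abbrev ResidueRing (f : invariantMonics D) : Type _ := DiffPoly D ⧸ idealOf f

/-- The structure map `B → A` of the ring extension `A / B`. -/
noncomputable def toResidue (f : invariantMonics D) : B →+* ResidueRing f :=
  (Ideal.Quotient.mk (idealOf f)).comp C

theorem mapCoeff_mem {f : invariantMonics D} {h : DiffPoly D} (hh : h ∈ idealOf f) :
    mapCoeff h ∈ idealOf f := by
  rw [mapCoeff_eq]
  exact (idealOf f).sub_mem ((idealOf f).mul_mem_right _ hh) ((idealOf f).mul_mem_left _ hh)

/-- The derivation `D̃` of `A` induced by `D`: `D̃ (∑ x ^ j * c j) = ∑ x ^ j * D (c j)`. -/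
noncomputable def inducedDerivation (f : invariantMonics D) : RingDerivation (ResidueRing f) where
  toAddMonoidHom := QuotientAddGroup.map (idealOf f).toAddSubgroup (idealOf f).toAddSubgroup
    mapCoeff (fun _ hh => mapCoeff_mem hh)
  leibniz' := by
    intro a b
    obtain ⟨g, rfl⟩ := Ideal.Quotient.mk_surjective a
    obtain ⟨h, rfl⟩ := Ideal.Quotient.mk_surjective b
    change Ideal.Quotient.mk (idealOf f) (mapCoeff (g * h)) =
      Ideal.Quotient.mk (idealOf f) (mapCoeff g * h + g * mapCoeff h)
    congr 1
    simp only [mapCoeff_eq]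
    noncomm_ring

theorem inducedDerivation_mk (f : invariantMonics D) (g : DiffPoly D) :
    inducedDerivation f (Ideal.Quotient.mk (idealOf f) g) =
      Ideal.Quotient.mk (idealOf f) (mapCoeff g) := rfl

theorem inducedDerivation_toResidue (f : invariantMonics D) (a : B) :
    inducedDerivation f (toResidue f a) = toResidue f (D a) := by
  change inducedDerivation f (Ideal.Quotient.mk (idealOf f) (monomial 0 a)) = _
  rw [inducedDerivation_mk, mapCoeff_monomial]
  rfl

/-- `V`, the centralizer of `B` in `A`. -/
noncomputable def V (f : invariantMonics D) : Subring (ResidueRing f) :=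
  Subring.centralizer (Set.range (toResidue f))

theorem inducedDerivation_mem_V {f : invariantMonics D} {h : ResidueRing f} (hh : h ∈ V f) :
    inducedDerivation f h ∈ V f := by
  rw [V, Subring.mem_centralizer_iff] at hh ⊢
  rintro _ ⟨a, rfl⟩
  have h1 := congrArg (inducedDerivation f) (hh _ ⟨a, rfl⟩)
  rw [RingDerivation.leibniz, RingDerivation.leibniz, inducedDerivation_toResidue,
    hh _ ⟨D a, rfl⟩, add_comm] at h1
  exact add_right_cancel h1

/-- `D̃` as an additive map `V → V`. -/
noncomputable def derivV (f : invariantMonics D) : V f →+ V f :=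
  ((inducedDerivation f).toAddMonoidHom.comp (V f).subtype.toAddMonoidHom).codRestrict (V f)
    (fun h => inducedDerivation_mem_V h.2)

/-- `V^D̃ = {v ∈ V | D̃ v = 0}`. -/
noncomputable def VD (f : invariantMonics D) : Subring (ResidueRing f) where
  carrier := {v | v ∈ V f ∧ inducedDerivation f v = 0}
  mul_mem' := by
    rintro a b ⟨ha, ha'⟩ ⟨hb, hb'⟩
    exact ⟨mul_mem ha hb, by rw [RingDerivation.leibniz, ha', hb', zero_mul, mul_zero, add_zero]⟩
  one_mem' := ⟨one_mem _, RingDerivation.map_one_eq_zero _⟩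
  add_mem' := by
    rintro a b ⟨ha, ha'⟩ ⟨hb, hb'⟩
    exact ⟨add_mem ha hb, by rw [map_add, ha', hb', add_zero]⟩
  zero_mem' := ⟨zero_mem _, map_zero _⟩
  neg_mem' := by
    rintro a ⟨ha, ha'⟩
    exact ⟨neg_mem ha, by rw [map_neg, ha', neg_zero]⟩

/-- The inclusion `V^D̃ → V`. -/
noncomputable def inj (f : invariantMonics D) : VD f →+* V f :=
  Subring.inclusion (fun _ h => h.1)

end DiffPoly

/-! ### Separable and weakly separable ring extensions -/

namespace RingExtension

variable {A B : Type*} [Ring A] [Ring B]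

/-- The subgroup of `A ⊗[ℤ] A` generated by the elements `a b ⊗ c - a ⊗ b c` with `b ∈ B`. -/
def balancing (φ : B →+* A) : AddSubgroup (A ⊗[ℤ] A) :=
  AddSubgroup.closure {t | ∃ (a c : A) (b : B), t = (a * φ b) ⊗ₜ[ℤ] c - a ⊗ₜ[ℤ] (φ b * c)}

/-- `A ⊗_B A`, for a homomorphism `φ : B →+* A` of not necessarily commutative rings. -/
abbrev TensorSq (φ : B →+* A) : Type _ := (A ⊗[ℤ] A) ⧸ balancing φ

/-- The left action `a • (x ⊗ y) = a x ⊗ y` of `A` on `A ⊗_B A`. -/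
noncomputable def lact (φ : B →+* A) (a : A) : TensorSq φ →+ TensorSq φ :=
  QuotientAddGroup.map _ _ ((LinearMap.mulLeft ℤ a).rTensor A).toAddMonoidHom <| by
    rw [balancing, AddSubgroup.closure_le]
    rintro _ ⟨x, y, b, rfl⟩
    refine AddSubgroup.subset_closure ⟨a * x, y, b, ?_⟩
    simp [mul_assoc]

/-- The right action `(x ⊗ y) • a = x ⊗ y a` of `A` on `A ⊗_B A`. -/
noncomputable def ract (φ : B →+* A) (a : A) : TensorSq φ →+ TensorSq φ :=
  QuotientAddGroup.map _ _ ((LinearMap.mulRight ℤ a).lTensor A).toAddMonoidHom <| by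
    rw [balancing, AddSubgroup.closure_le]
    rintro _ ⟨x, y, b, rfl⟩
    refine AddSubgroup.subset_closure ⟨x, y * a, b, ?_⟩
    simp [mul_assoc]

/-- The multiplication map `A ⊗_B A → A`, `x ⊗ y ↦ x y`. -/
noncomputable def mulMap (φ : B →+* A) : TensorSq φ →+ A :=
  QuotientAddGroup.lift _ (LinearMap.mul' ℤ A).toAddMonoidHom <| by
    rw [balancing, AddSubgroup.closure_le]
    rintro _ ⟨x, y, b, rfl⟩
    simp [mul_assoc]

/-- `A / B` is separable: the multiplication map `A ⊗_B A → A` splits as an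
`A`-`A`-homomorphism. -/
def IsSeparable (φ : B →+* A) : Prop :=
  ∃ s : A →+ TensorSq φ,
    (∀ a x, s (a * x) = lact φ a (s x)) ∧ (∀ x a, s (x * a) = ract φ a (s x)) ∧
      ∀ x, mulMap φ (s x) = x

/-- `A / B` is weakly separable: every `B`-derivation of `A` to `A` is inner. -/
def IsWeaklySeparable (φ : B →+* A) : Prop :=
  ∀ δ : RingDerivation A, (∀ b, δ (φ b) = 0) → ∃ m, ∀ x, δ x = m * x - x * m

end RingExtension

namespace DiffPoly

variable {B : Type*} [Ring B] {D : RingDerivation B}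

/-- `f` is a separable polynomial in `B[X;D]`. -/
def IsSeparablePoly (f : invariantMonics D) : Prop :=
  RingExtension.IsSeparable (toResidue f)

/-- `f` is a weakly separable polynomial in `B[X;D]`. -/
def IsWeaklySeparablePoly (f : invariantMonics D) : Prop :=
  RingExtension.IsWeaklySeparable (toResidue f)

end DiffPoly

/-! ### Commuting elements in characteristic `p` -/

/-! On `A` the derivation D̃ is y ↦ yx - xy, the difference of two commuting operators. In
characteristic p its power of exponent p^j - 1 sends v to ∑ x^k v x^(p^j-1-k), which is δ(x^(p^j))
for any derivation δ with δ(x) = v. As the b_{j+1} are central in `A`, τ(v) is thus the formal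
derivative of f at x along v (`trace_eq_sum`).

Weak separability: δ ↦ δ(x) identifies the B-derivations of `A` with ker τ ⊆ V (`exists_derivation`,
`trace_derivation_root`), and the inner ones with D̃(V). Exactness at the second V says that the two
agree; the earlier part of the sequence is always exact.

Separability means a Casimir element of product 1 in A ⊗_B A. If τ(h) = 1, running the formula for τ
on h ⊗ 1 yields one (`isSeparable_of_trace_eq_one`). Conversely, A/B is a Frobenius extension
through the top-coefficient map π, and id ⊗ π sends such an element to some h with τ(h) = 1
(`exists_trace_eq_one`). By V^D̃-linearity, τ is onto as soon as it reaches 1. Exactness at V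
follows because separable extensions are weakly separable. -/

theorem Nat.Prime.cast_choose_pow_sub_one_mul_neg_one_pow {E : Type*} [Ring E] {p : ℕ}
    (hp : p.Prime) (hE : (p : E) = 0) (n : ℕ) {k : ℕ} (hk : k < p ^ n) :
    ((p ^ n - 1).choose k : E) * (-1) ^ k = 1 := by
  induction k with
  | zero => simp
  | succ k ih =>
    -- By Pascal's rule two consecutive coefficients of row p^n - 1 add up to one of row p^n, which
    -- vanishes; so they are opposite.
    have hdvd : p ∣ (p ^ n).choose (k + 1) := hp.dvd_choose_pow k.succ_ne_zero hk.ne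
    have h0 : ((p ^ n).choose (k + 1) : E) = 0 := by
      obtain ⟨c, hc⟩ := hdvd
      rw [hc, Nat.cast_mul, hE, zero_mul]
    have hq : p ^ n = (p ^ n - 1) + 1 := by omega
    rw [hq, Nat.choose_succ_succ, Nat.cast_add] at h0
    rw [eq_neg_of_add_eq_zero_right h0, pow_succ, mul_neg_one, neg_mul_neg, ih (by omega)]

/-- In the binomial expansion of the right side every signed coefficient is 1. -/
theorem Commute.sum_pow_mul_pow_eq_sub_pow {E : Type*} [Ring E] {p : ℕ} (hp : p.Prime)
    (hE : (p : E) = 0) {l r : E} (h : Commute l r) (n : ℕ) :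
    ∑ k ∈ Finset.range (p ^ n), l ^ k * r ^ (p ^ n - 1 - k) = (r - l) ^ (p ^ n - 1) := by
  have hq : p ^ n - 1 + 1 = p ^ n := Nat.sub_add_cancel (Nat.pow_pos hp.pos)
  rw [sub_eq_neg_add, h.neg_left.add_pow, hq]
  refine Finset.sum_congr rfl fun k hk => ?_
  rw [← Nat.cast_comm, neg_pow, ← mul_assoc, ← mul_assoc,
    hp.cast_choose_pow_sub_one_mul_neg_one_pow hE n (Finset.mem_range.1 hk), one_mul]

theorem Commute.sub_pow_prime_pow {E : Type*} [Ring E] {p : ℕ} (hp : p.Prime)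
    (hE : (p : E) = 0) {l r : E} (h : Commute l r) (n : ℕ) :
    (r - l) ^ p ^ n = r ^ p ^ n - l ^ p ^ n := by
  have hq : p ^ n - 1 + 1 = p ^ n := Nat.sub_add_cancel (Nat.pow_pos hp.pos)
  have h1 := h.geom_sum₂_mul (p ^ n)
  rw [h.sum_pow_mul_pow_eq_sub_pow hp hE n, ← neg_sub r l, mul_neg, ← pow_succ, hq] at h1
  rw [← neg_eq_iff_eq_neg.2 (neg_sub (r ^ p ^ n) (l ^ p ^ n)).symm, ← h1, neg_neg]

theorem AddMonoid.End.natCast_eq_zero {M : Type*} [AddCommGroup M] {p : ℕ}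
    (h : ∀ m : M, p • m = 0) : (p : AddMonoid.End M) = 0 := by
  ext m
  exact h m

theorem AddMonoid.End.mul_apply' {M : Type*} [AddCommGroup M] (f g : AddMonoid.End M) (m : M) :
    (f * g) m = f (g m) := rfl

theorem AddMonoid.End.sub_apply' {M : Type*} [AddCommGroup M] (f g : AddMonoid.End M) (m : M) :
    (f - g) m = f m - g m := rfl

theorem AddMonoid.End.sum_apply' {M ι : Type*} [AddCommGroup M] (s : Finset ι)
    (f : ι → AddMonoid.End M) (m : M) : (∑ i ∈ s, f i) m = ∑ i ∈ s, f i m :=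
  AddMonoidHom.finsetSum_apply f s m

/-- The inner derivation `a ↦ a * x - x * a`, as an additive endomorphism. -/
def commOp {A : Type*} [Ring A] (x : A) : AddMonoid.End A :=
  AddMonoid.End.mulRight x - AddMonoid.End.mulLeft x

section CommOp

variable {A : Type*} [Ring A]

theorem commOp_apply (x a : A) : commOp x a = a * x - x * a := rfl

theorem mulLeft_pow_apply (x a : A) (n : ℕ) :
    (AddMonoid.End.mulLeft x ^ n) a = x ^ n * a := by
  induction n generalizing a with
  | zero => simp
  | succ n ih =>
    rw [pow_succ, AddMonoid.End.mul_apply', ih, pow_succ, mul_assoc]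
    rfl

theorem mulRight_pow_apply (x a : A) (n : ℕ) :
    (AddMonoid.End.mulRight x ^ n) a = a * x ^ n := by
  induction n generalizing a with
  | zero => simp
  | succ n ih =>
    rw [pow_succ, AddMonoid.End.mul_apply', ih, pow_succ', ← mul_assoc]
    rfl

theorem commute_mulLeft_mulRight (x y : A) :
    Commute (AddMonoid.End.mulLeft x) (AddMonoid.End.mulRight y) := by
  ext a
  exact (mul_assoc x a y).symm

theorem AddMonoid.End.natCast_eq_zero_of_ring {p : ℕ} (hA : (p : A) = 0) :
    (p : AddMonoid.End A) = 0 :=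
  AddMonoid.End.natCast_eq_zero fun a => by rw [nsmul_eq_mul, hA, zero_mul]

/-- The bridge between iterates of D̃ and derivations: the right side is what the Leibniz rule gives
for x^(p^n) when x has derivative v. -/
theorem commOp_pow_sub_one_apply {p : ℕ} (hp : p.Prime) (hA : (p : A) = 0) (x v : A) (n : ℕ) :
    (commOp x ^ (p ^ n - 1)) v =
      ∑ k ∈ Finset.range (p ^ n), x ^ k * v * x ^ (p ^ n - 1 - k) := by
  rw [commOp, ← (commute_mulLeft_mulRight x x).sum_pow_mul_pow_eq_sub_pow hp
    (AddMonoid.End.natCast_eq_zero_of_ring hA) n, AddMonoid.End.sum_apply']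
  refine Finset.sum_congr rfl fun k _ => ?_
  rw [AddMonoid.End.mul_apply', mulRight_pow_apply, mulLeft_pow_apply, mul_assoc]

theorem commOp_pow_apply {p : ℕ} (hp : p.Prime) (hA : (p : A) = 0) (x v : A) (n : ℕ) :
    (commOp x ^ p ^ n) v = v * x ^ p ^ n - x ^ p ^ n * v := by
  rw [commOp, (commute_mulLeft_mulRight x x).sub_pow_prime_pow hp
    (AddMonoid.End.natCast_eq_zero_of_ring hA) n, AddMonoid.End.sub_apply',
    mulRight_pow_apply, mulLeft_pow_apply]

end CommOp

/-! ### Degrees and division in `B[X;D]` -/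

namespace DiffPoly

variable {B : Type*} [Ring B] {D : RingDerivation B}

theorem ext_coeff {g h : DiffPoly D} (H : ∀ n, g.coeff n = h.coeff n) : g = h :=
  Finsupp.ext (M := B) H

theorem coeff_add (g h : DiffPoly D) (n : ℕ) : (g + h).coeff n = g.coeff n + h.coeff n := rfl

theorem coeff_sub (g h : DiffPoly D) (n : ℕ) : (g - h).coeff n = g.coeff n - h.coeff n := rfl

theorem coeff_zero (n : ℕ) : (0 : DiffPoly D).coeff n = 0 := rfl

theorem coeff_monomial (i n : ℕ) (a : B) :
    (monomial i a : DiffPoly D).coeff n = if i = n then a else 0 :=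
  Finsupp.single_apply

/-- The coefficient of `X ^ n`, as an additive map. -/
def coeffHom (n : ℕ) : DiffPoly D →+ B where
  toFun g := g.coeff n
  map_zero' := rfl
  map_add' _ _ := rfl

theorem coeff_sum {ι : Type*} (s : Finset ι) (g : ι → DiffPoly D) (n : ℕ) :
    (∑ i ∈ s, g i).coeff n = ∑ i ∈ s, (g i).coeff n :=
  map_sum (coeffHom n) g s

theorem coeff_shift_zero (g : DiffPoly D) : (shift g).coeff 0 = 0 := by
  have : (coeffHom 0).comp (shift (D := D)) = 0 := hom_ext fun i a => by
    change (shift (monomial i a)).coeff 0 = 0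
    rw [shift_monomial, coeff_monomial, if_neg i.succ_ne_zero]
  exact DFunLike.congr_fun this g

theorem coeff_shift_succ (g : DiffPoly D) (n : ℕ) : (shift g).coeff (n + 1) = g.coeff n := by
  have : (coeffHom (n + 1)).comp (shift (D := D)) = coeffHom n := hom_ext fun i a => by
    change (shift (monomial i a)).coeff (n + 1) = (monomial i a : DiffPoly D).coeff n
    simp [shift_monomial, coeff_monomial]
  exact DFunLike.congr_fun this g

variable (D) in
/-- The polynomials of degree less than `n`. -/
def degreeLT (n : ℕ) : AddSubgroup (DiffPoly D) where
  carrier := {g | ∀ k, n ≤ k → g.coeff k = 0}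
  zero_mem' := fun _ _ => rfl
  add_mem' := fun hg hh k hk => by rw [coeff_add, hg k hk, hh k hk, add_zero]
  neg_mem' := fun {g} hg k hk => by
    rw [← zero_sub, coeff_sub, hg k hk, coeff_zero, sub_zero]

theorem degreeLT_mono {m n : ℕ} (h : m ≤ n) : degreeLT D m ≤ degreeLT D n :=
  fun _ hg k hk => hg k (h.trans hk)

theorem mem_degreeLT_of_succ {n : ℕ} {g : DiffPoly D} (hg : g ∈ degreeLT D (n + 1))
    (h : g.coeff n = 0) : g ∈ degreeLT D n := fun k hk => by
  rcases hk.eq_or_lt with rfl | hk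
  · exact h
  · exact hg k hk

theorem monomial_mem_degreeLT {i n : ℕ} (h : i < n) (a : B) :
    (monomial i a : DiffPoly D) ∈ degreeLT D n := fun k hk => by
  rw [coeff_monomial, if_neg (by omega)]

theorem exists_mem_degreeLT (g : DiffPoly D) : ∃ n, g ∈ degreeLT D n := by
  obtain ⟨n, hn⟩ := (show ℕ →₀ B from g).support.exists_nat_subset_range
  refine ⟨n, fun k hk => ?_⟩
  by_contra hne
  have := Finset.mem_range.1 (hn (Finsupp.mem_support_iff.2 hne))
  omega

theorem shift_mem_degreeLT {n : ℕ} {g : DiffPoly D} (hg : g ∈ degreeLT D n) :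
    shift g ∈ degreeLT D (n + 1) := fun k hk => by
  obtain ⟨k, rfl⟩ : ∃ l, k = l + 1 := ⟨k - 1, by omega⟩
  rw [coeff_shift_succ]
  exact hg k (by omega)

theorem exists_eq_C_add_shift {n : ℕ} {g : DiffPoly D} (hg : g ∈ degreeLT D (n + 1)) :
    ∃ a, ∃ h ∈ degreeLT D n, g = monomial 0 a + shift h := by
  let h : DiffPoly D := Finsupp.comapDomain (· + 1) (show ℕ →₀ B from g)
    (add_left_injective 1).injOn
  have hc : ∀ k, h.coeff k = g.coeff (k + 1) := fun k => rfl
  refine ⟨g.coeff 0, h, fun k hk => (hc k).trans (hg _ (by omega)), ext_coeff fun k => ?_⟩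
  rw [coeff_add, coeff_monomial]
  cases k with
  | zero => rw [coeff_shift_zero, if_pos rfl, add_zero]
  | succ k => rw [coeff_shift_succ, hc, if_neg (by omega), zero_add]

theorem shift_mul' (g h : DiffPoly D) : shift g * h = shift (g * h) := shift_mul g h

/-- Moving a constant past X creates only a term of lower degree. -/
theorem const_mul_mem_degreeLT {n : ℕ} {g : DiffPoly D} (hg : g ∈ degreeLT D (n + 1)) (a : B) :
    monomial 0 a * g ∈ degreeLT D (n + 1) ∧ (monomial 0 a * g).coeff n = a * g.coeff n := by
  induction n generalizing a g with
  | zero =>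
    obtain ⟨c, h, hh, rfl⟩ := exists_eq_C_add_shift hg
    obtain rfl : h = 0 := ext_coeff fun k => hh k k.zero_le
    have : (monomial 0 a * monomial 0 c : DiffPoly D) = monomial 0 (a * c) := by
      simp [monomial_mul_monomial]
    rw [map_zero, add_zero, this, coeff_monomial, coeff_monomial]
    exact ⟨monomial_mem_degreeLT one_pos _, by simp⟩
  | succ n ih =>
    obtain ⟨c, h, hh, rfl⟩ := exists_eq_C_add_shift hg
    have h0 : (monomial 0 a * monomial 0 c : DiffPoly D) = monomial 0 (a * c) := by
      simp [monomial_mul_monomial]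
    have h1 : monomial 0 a * shift h = shift (monomial 0 a * h) + monomial 0 (D a) * h :=
      const_mul_shift a h
    have h2 := ih hh a
    have h3 := ih hh (D a)
    rw [mul_add, h0, h1]
    refine ⟨add_mem (monomial_mem_degreeLT (by omega) _)
      (add_mem (shift_mem_degreeLT h2.1) (degreeLT_mono (by omega) h3.1)), ?_⟩
    rw [coeff_add, coeff_add, coeff_shift_succ, h2.2, h3.1 _ le_rfl, coeff_monomial,
      if_neg (by omega), coeff_add, coeff_shift_succ, coeff_monomial, if_neg (by omega)]
    simp

theorem mul_mem_degreeLT {m n : ℕ} {g q : DiffPoly D} (hg : g ∈ degreeLT D (m + 1))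
    (hq : q ∈ degreeLT D (n + 1)) :
    g * q ∈ degreeLT D (m + n + 1) ∧ (g * q).coeff (m + n) = g.coeff m * q.coeff n := by
  induction m generalizing g with
  | zero =>
    obtain ⟨c, h, hh, rfl⟩ := exists_eq_C_add_shift hg
    obtain rfl : h = 0 := ext_coeff fun k => hh k k.zero_le
    rw [map_zero, add_zero, coeff_monomial, zero_add]
    exact const_mul_mem_degreeLT hq c
  | succ m ih =>
    obtain ⟨c, h, hh, rfl⟩ := exists_eq_C_add_shift hg
    have h1 := const_mul_mem_degreeLT hq c
    have h2 := ih hh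
    rw [add_mul, shift_mul']
    have e : m + 1 + n = m + n + 1 := by omega
    refine ⟨add_mem (degreeLT_mono (by omega) h1.1) (e ▸ shift_mem_degreeLT h2.1), ?_⟩
    rw [coeff_add, e, coeff_shift_succ, h2.2, h1.1 _ (by omega), coeff_add, coeff_shift_succ,
      coeff_monomial, if_neg (by omega)]
    simp

/-- Since f is monic, the leading coefficient of the product is that of q; the coefficients of q
vanish from the top down. -/
theorem eq_zero_of_mul_mem_degreeLT {m : ℕ} {f q : DiffPoly D} (hf : f ∈ degreeLT D (m + 1))
    (hm : f.coeff m = 1) (h : f * q ∈ degreeLT D m) : q = 0 := by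
  obtain ⟨n, hn⟩ := exists_mem_degreeLT q
  induction n with
  | zero => exact ext_coeff fun k => hn k k.zero_le
  | succ n ih =>
    refine ih (mem_degreeLT_of_succ hn ?_)
    have := (mul_mem_degreeLT hf hn).2
    rwa [h _ (by omega), hm, one_mul, eq_comm] at this

theorem exists_eq_mul_add {m : ℕ} {f : DiffPoly D} (hf : f ∈ degreeLT D (m + 1))
    (hm : f.coeff m = 1) (g : DiffPoly D) : ∃ q, ∃ r ∈ degreeLT D m, g = f * q + r := by
  obtain ⟨n, hn⟩ := exists_mem_degreeLT g
  induction n generalizing g with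
  | zero => exact ⟨0, g, degreeLT_mono m.zero_le hn, by simp⟩
  | succ n ih =>
    by_cases hnm : n + 1 ≤ m
    · exact ⟨0, g, degreeLT_mono hnm hn, by simp⟩
    obtain ⟨k, rfl⟩ : ∃ k, n = m + k := ⟨n - m, by omega⟩
    have h1 := mul_mem_degreeLT hf
      (monomial_mem_degreeLT (D := D) k.lt_succ_self (g.coeff (m + k)))
    obtain ⟨q, r, hr, hqr⟩ := ih (g - f * monomial k (g.coeff (m + k)))
      (mem_degreeLT_of_succ (sub_mem hn h1.1) (by
        rw [coeff_sub, h1.2, hm, coeff_monomial, if_pos rfl, one_mul, sub_self]))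
    refine ⟨q + monomial k (g.coeff (m + k)), r, hr, ?_⟩
    rw [mul_add, add_right_comm, ← hqr, sub_add_cancel]

end DiffPoly

/-! ### Separability by means of Casimir elements -/

namespace RingExtension

variable {A B : Type*} [Ring A] [Ring B] (φ : B →+* A)

/-- The element `a ⊗ c` of `A ⊗_B A`. -/
def tmul (a c : A) : TensorSq φ := QuotientAddGroup.mk (a ⊗ₜ[ℤ] c)

variable {φ} in
theorem tensorSq_hom_ext {N : Type*} [AddCommGroup N] {F G : TensorSq φ →+ N}
    (h : ∀ a c, F (tmul φ a c) = G (tmul φ a c)) : F = G := by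
  refine QuotientAddGroup.addMonoidHom_ext _ (AddMonoidHom.ext fun t => ?_)
  induction t using TensorProduct.induction_on with
  | zero => rw [map_zero, map_zero]
  | tmul a c => exact h a c
  | add s t hs ht => rw [map_add, map_add, hs, ht]

/-- The additive map on `A ⊗_B A` induced by a balanced biadditive map. -/
noncomputable def tensorSqLift {N : Type*} [AddCommGroup N] (F : A →+ A →+ N)
    (hF : ∀ a c b, F (a * φ b) c = F a (φ b * c)) : TensorSq φ →+ N :=
  QuotientAddGroup.lift _ (TensorProduct.liftAddHom (R := ℤ) F fun r a c => by
    rw [map_zsmul, map_zsmul, AddMonoidHom.zsmul_apply]) <| by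
    rw [balancing, AddSubgroup.closure_le]
    rintro _ ⟨a, c, b, rfl⟩
    simp [hF]

theorem tmul_add (a c d : A) : tmul φ a (c + d) = tmul φ a c + tmul φ a d := by
  rw [tmul, TensorProduct.tmul_add]; rfl

theorem add_tmul (a c d : A) : tmul φ (a + c) d = tmul φ a d + tmul φ c d := by
  rw [tmul, TensorProduct.add_tmul]; rfl

/-- `c ↦ a ⊗ c`. -/
def tmulLeft (a : A) : A →+ TensorSq φ := AddMonoidHom.mk' (tmul φ a) (tmul_add φ a)

/-- `a ↦ a ⊗ c`. -/
def tmulRight (c : A) : A →+ TensorSq φ :=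
  AddMonoidHom.mk' (fun a => tmul φ a c) fun a d => add_tmul φ a d c

theorem mul_tmul (a c : A) (b : B) : tmul φ (a * φ b) c = tmul φ a (φ b * c) := by
  refine (QuotientAddGroup.eq_iff_sub_mem).2 (AddSubgroup.subset_closure ⟨a, c, b, rfl⟩)

theorem lact_tmul (y a c : A) : lact φ y (tmul φ a c) = tmul φ (y * a) c := rfl

theorem ract_tmul (y a c : A) : ract φ y (tmul φ a c) = tmul φ a (c * y) := rfl

theorem mulMap_tmul (a c : A) : mulMap φ (tmul φ a c) = a * c := rfl

theorem lact_mul (y z : A) (t : TensorSq φ) : lact φ (y * z) t = lact φ y (lact φ z t) :=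
  DFunLike.congr_fun (tensorSq_hom_ext (F := lact φ (y * z)) (G := (lact φ y).comp (lact φ z))
    fun a c => by simp [lact_tmul, mul_assoc]) t

theorem ract_mul (y z : A) (t : TensorSq φ) : ract φ (y * z) t = ract φ z (ract φ y t) :=
  DFunLike.congr_fun (tensorSq_hom_ext (F := ract φ (y * z)) (G := (ract φ z).comp (ract φ y))
    fun a c => by simp [ract_tmul, mul_assoc]) t

theorem lact_ract (y z : A) (t : TensorSq φ) : lact φ y (ract φ z t) = ract φ z (lact φ y t) :=
  DFunLike.congr_fun (tensorSq_hom_ext (F := (lact φ y).comp (ract φ z))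
    (G := (ract φ z).comp (lact φ y)) fun a c => by simp [ract_tmul, lact_tmul]) t

theorem lact_add (y z : A) (t : TensorSq φ) : lact φ (y + z) t = lact φ y t + lact φ z t :=
  DFunLike.congr_fun (tensorSq_hom_ext (F := lact φ (y + z)) (G := lact φ y + lact φ z)
    fun a c => by simp [lact_tmul, add_mul, add_tmul]) t

theorem ract_add (y z : A) (t : TensorSq φ) : ract φ (y + z) t = ract φ y t + ract φ z t :=
  DFunLike.congr_fun (tensorSq_hom_ext (F := ract φ (y + z)) (G := ract φ y + ract φ z)
    fun a c => by simp [ract_tmul, mul_add, tmul_add]) t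

theorem mulMap_lact (y : A) (t : TensorSq φ) : mulMap φ (lact φ y t) = y * mulMap φ t :=
  DFunLike.congr_fun (tensorSq_hom_ext (F := (mulMap φ).comp (lact φ y))
    (G := (AddMonoidHom.mulLeft y).comp (mulMap φ))
    fun a c => by simp [lact_tmul, mulMap_tmul, mul_assoc]) t

theorem mulMap_ract (y : A) (t : TensorSq φ) : mulMap φ (ract φ y t) = mulMap φ t * y :=
  DFunLike.congr_fun (tensorSq_hom_ext (F := (mulMap φ).comp (ract φ y))
    (G := (AddMonoidHom.mulRight y).comp (mulMap φ))
    fun a c => by simp [ract_tmul, mulMap_tmul, mul_assoc]) t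

/-- `A / B` is separable if and only if `A ⊗_B A` has a Casimir element of product `1`. -/
theorem isSeparable_iff_exists_casimir :
    IsSeparable φ ↔ ∃ t : TensorSq φ, (∀ a, lact φ a t = ract φ a t) ∧ mulMap φ t = 1 := by
  constructor
  · rintro ⟨s, hl, hr, hs⟩
    exact ⟨s 1, fun a => by rw [← hl, ← hr, mul_one, one_mul], hs 1⟩
  · rintro ⟨t, ht, h1⟩
    refine ⟨AddMonoidHom.mk' (fun a => lact φ a t) fun a c => lact_add φ a c t,
      fun a y => lact_mul φ a y t, fun y a => ?_, fun y => ?_⟩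
    · change lact φ (y * a) t = ract φ a (lact φ y t)
      rw [lact_mul, ht a, lact_ract]
    · change mulMap φ (lact φ y t) = y
      rw [mulMap_lact, h1, mul_one]

variable {φ} in
-- Let G(a ⊗ c) = δ(a)c, balanced because δ kills B. For a Casimir element t of product 1, G(yt) =
-- δ(y) + yG(t) and G(ty) = G(t)y, so δ is inner through G(t).
theorem IsSeparable.isWeaklySeparable (h : IsSeparable φ) : IsWeaklySeparable φ := by
  obtain ⟨t, ht, h1⟩ := (isSeparable_iff_exists_casimir φ).1 h
  intro δ hδ
  let G : TensorSq φ →+ A := tensorSqLift φ (AddMonoidHom.mul.comp δ.toAddMonoidHom) fun a c b => by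
    change δ (a * φ b) * c = δ a * (φ b * c)
    rw [δ.leibniz, hδ, mul_zero, add_zero, mul_assoc]
  have hG : ∀ a c, G (tmul φ a c) = δ a * c := fun a c => rfl
  have hl : ∀ y u, G (lact φ y u) = δ y * mulMap φ u + y * G u := fun y u =>
    DFunLike.congr_fun (tensorSq_hom_ext (F := G.comp (lact φ y))
      (G := (AddMonoidHom.mulLeft (δ y)).comp (mulMap φ) + (AddMonoidHom.mulLeft y).comp G)
      fun a c => by simp [lact_tmul, mulMap_tmul, hG, δ.leibniz, add_mul, mul_assoc]) u
  have hr : ∀ y u, G (ract φ y u) = G u * y := fun y u =>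
    DFunLike.congr_fun (tensorSq_hom_ext (F := G.comp (ract φ y))
      (G := (AddMonoidHom.mulRight y).comp G)
      fun a c => by simp [ract_tmul, hG, mul_assoc]) u
  refine ⟨G t, fun y => ?_⟩
  have := hl y t
  rw [ht, hr, h1, mul_one] at this
  rw [this, add_sub_cancel_right]

end RingExtension

/-! ### Extensions generated by a root of a `p`-polynomial -/

/-- `A` is generated over `B` by an element `x` with `a x = x a + D a` for `a ∈ B`, which is a root
of a `p`-polynomial `∑ X ^ (p ^ j) * b (j + 1) + b 0` whose nonconstant coefficients are central
in `A`. -/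
structure IsPPolyExtension {A B : Type*} [Ring A] [Ring B] (p e : ℕ) (D : RingDerivation B)
    (b : ℕ → B) (φ : B →+* A) (x : A) : Prop where
  prime : p.Prime
  cast_eq_zero : (p : A) = 0
  comm_root : ∀ a, φ a * x = x * φ a + φ (D a)
  root : ∑ j ∈ Finset.range (e + 1), x ^ p ^ j * φ (b (j + 1)) + φ (b 0) = 0
  central : ∀ j ∈ Finset.range (e + 1), ∀ a, a * φ (b (j + 1)) = φ (b (j + 1)) * a
  generates : ∀ S : AddSubgroup A, (∀ a, φ a ∈ S) → (∀ y ∈ S, x * y ∈ S) → ∀ y, y ∈ S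

namespace IsPPolyExtension

open RingExtension

variable {A B : Type*} [Ring A] [Ring B] {p e : ℕ} {D : RingDerivation B} {b : ℕ → B}
  {φ : B →+* A} {x : A}

/-- Coefficients can be moved to the left of powers of x. This form suits maps that are left
B-linear and commute with right multiplication by x. -/
theorem generates_left (H : IsPPolyExtension p e D b φ x) {S : AddSubgroup A}
    (h : ∀ a l, φ a * x ^ l ∈ S) (y : A) : y ∈ S := by
  have hS : AddSubgroup.closure {y | ∃ a l, y = φ a * x ^ l} ≤ S := by
    rw [AddSubgroup.closure_le]
    rintro _ ⟨a, l, rfl⟩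
    exact h a l
  refine hS (H.generates (AddSubgroup.closure {y | ∃ a l, y = φ a * x ^ l})
    (fun a => AddSubgroup.subset_closure ⟨a, 0, by simp⟩) ?_ y)
  intro y hy
  induction hy using AddSubgroup.closure_induction with
  | mem y hy =>
    obtain ⟨a, l, rfl⟩ := hy
    have : x * (φ a * x ^ l) = φ a * x ^ (l + 1) - φ (D a) * x ^ l := by
      rw [pow_succ', ← mul_assoc, ← mul_assoc, H.comm_root, add_mul, add_sub_cancel_right]
    rw [this]
    exact sub_mem (AddSubgroup.subset_closure ⟨a, l + 1, rfl⟩)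
      (AddSubgroup.subset_closure ⟨D a, l, rfl⟩)
  | zero => rw [mul_zero]; exact zero_mem _
  | add y z _ _ hy hz => rw [mul_add]; exact add_mem hy hz
  | neg y _ hy => rw [mul_neg]; exact neg_mem hy

theorem root_eq (H : IsPPolyExtension p e D b φ x) :
    ∑ j ∈ Finset.range (e + 1), x ^ p ^ j * φ (b (j + 1)) = -φ (b 0) :=
  eq_neg_of_add_eq_zero_left H.root

variable (p e b φ x) in
/-- The trace-like map `v ↦ ∑ j, (ad x) ^ (p ^ j - 1) v * b (j + 1)`. -/
def trace : A →+ A :=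
  ∑ j ∈ Finset.range (e + 1),
    (AddMonoidHom.mulRight (φ (b (j + 1)))).comp (commOp x ^ (p ^ j - 1) : AddMonoid.End A)

theorem trace_apply (v : A) : trace p e b φ x v =
    ∑ j ∈ Finset.range (e + 1), (commOp x ^ (p ^ j - 1)) v * φ (b (j + 1)) :=
  AddMonoidHom.finsetSum_apply _ _ _

theorem trace_eq_sum (H : IsPPolyExtension p e D b φ x) (v : A) : trace p e b φ x v =
    ∑ j ∈ Finset.range (e + 1), (∑ k ∈ Finset.range (p ^ j), x ^ k * v * x ^ (p ^ j - 1 - k)) *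
      φ (b (j + 1)) := by
  simp only [trace_apply, commOp_pow_sub_one_apply H.prime H.cast_eq_zero]

/-- The p^j-th power of ad x is ad of x^(p^j), so the sum is a commutator of v with f(x) - b_0 =
-b_0. -/
theorem sum_commOp_pow (H : IsPPolyExtension p e D b φ x) {v : A}
    (hv : φ (b 0) * v = v * φ (b 0)) :
    ∑ j ∈ Finset.range (e + 1), (commOp x ^ p ^ j) v * φ (b (j + 1)) = 0 := by
  have h1 : ∀ j ∈ Finset.range (e + 1), (commOp x ^ p ^ j) v * φ (b (j + 1)) =
      v * (x ^ p ^ j * φ (b (j + 1))) - x ^ p ^ j * φ (b (j + 1)) * v := fun j hj => by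
    rw [commOp_pow_apply H.prime H.cast_eq_zero, sub_mul, mul_assoc, mul_assoc, mul_assoc,
      H.central j hj v]
  rw [Finset.sum_congr rfl h1, Finset.sum_sub_distrib, ← Finset.mul_sum, ← Finset.sum_mul,
    H.root_eq, mul_neg, neg_mul, hv, sub_self]

theorem commOp_mul_central {x c : A} (h : ∀ a, a * c = c * a) (v : A) :
    commOp x (v * c) = commOp x v * c := by
  rw [commOp_apply, commOp_apply, sub_mul, mul_assoc, ← h x, mul_assoc, mul_assoc]

/-- Composing the trace with ad x, on either side, raises each exponent p^j - 1 to p^j and gives the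
vanishing sum above. -/
theorem commOp_trace (H : IsPPolyExtension p e D b φ x) {v : A}
    (hv : φ (b 0) * v = v * φ (b 0)) : commOp x (trace p e b φ x v) = 0 := by
  rw [← H.sum_commOp_pow hv, trace_apply, map_sum]
  refine Finset.sum_congr rfl fun j hj => ?_
  have hq : p ^ j - 1 + 1 = p ^ j := Nat.sub_add_cancel (Nat.pow_pos H.prime.pos)
  rw [commOp_mul_central (H.central j hj), ← AddMonoid.End.mul_apply', ← pow_succ', hq]

theorem trace_commOp (H : IsPPolyExtension p e D b φ x) {v : A}
    (hv : φ (b 0) * v = v * φ (b 0)) : trace p e b φ x (commOp x v) = 0 := by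
  rw [← H.sum_commOp_pow hv, trace_apply]
  refine Finset.sum_congr rfl fun j hj => ?_
  have hq : p ^ j - 1 + 1 = p ^ j := Nat.sub_add_cancel (Nat.pow_pos H.prime.pos)
  rw [← AddMonoid.End.mul_apply', ← pow_succ, hq]

theorem commOp_mul_mul {s t : A} (hs : commOp x s = 0) (ht : commOp x t = 0) (v : A) :
    commOp x (s * v * t) = s * commOp x v * t := by
  rw [commOp_apply, sub_eq_zero] at hs ht
  rw [commOp_apply, commOp_apply, mul_assoc, ht, mul_assoc s v t, ← mul_assoc x, ← hs]
  noncomm_ring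

theorem trace_mul_mul (H : IsPPolyExtension p e D b φ x) {s t : A} (hs : commOp x s = 0)
    (ht : commOp x t = 0) (v : A) :
    trace p e b φ x (s * v * t) = s * trace p e b φ x v * t := by
  have hn : ∀ n, (commOp x ^ n) (s * v * t) = s * (commOp x ^ n) v * t := fun n => by
    induction n with
    | zero => rfl
    | succ n ih =>
      rw [pow_succ', AddMonoid.End.mul_apply', ih, commOp_mul_mul hs ht]
      rfl
  rw [trace_apply, trace_apply, Finset.mul_sum, Finset.sum_mul]
  refine Finset.sum_congr rfl fun j hj => ?_
  rw [hn, mul_assoc, H.central j hj t, ← mul_assoc, mul_assoc s]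

/-- Elements of `A ⊗_B A` commuting with `B` and `x` are Casimir elements. -/
theorem casimir_of_generators (H : IsPPolyExtension p e D b φ x) {t : TensorSq φ}
    (hB : ∀ a, lact φ (φ a) t = ract φ (φ a) t) (hx : lact φ x t = ract φ x t) (y : A) :
    lact φ y t = ract φ y t := by
  let S : AddSubgroup A :=
    (AddMonoidHom.mk' (fun y => lact φ y t) fun y z => lact_add φ y z t).eqLocus
      (AddMonoidHom.mk' (fun y => ract φ y t) fun y z => ract_add φ y z t)
  refine H.generates S hB (fun y hy => ?_) y
  change lact φ (x * y) t = ract φ (x * y) t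
  have hy : lact φ y t = ract φ y t := hy
  rw [lact_mul, hy, lact_ract, hx, ract_mul]

/-- The left action of an element, in the endomorphism ring of `A ⊗_B A`. -/
noncomputable def lactEnd (φ : B →+* A) (y : A) : AddMonoid.End (TensorSq φ) := lact φ y

/-- The right action of an element, in the endomorphism ring of `A ⊗_B A`. -/
noncomputable def ractEnd (φ : B →+* A) (y : A) : AddMonoid.End (TensorSq φ) := ract φ y

/-- The operator `u ↦ u x - x u` of the bimodule `A ⊗_B A`. -/
noncomputable def tensorCommOp (φ : B →+* A) (x : A) : AddMonoid.End (TensorSq φ) :=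
  ractEnd φ x - lactEnd φ x

theorem tensorCommOp_apply (u : TensorSq φ) :
    tensorCommOp φ x u = ract φ x u - lact φ x u := rfl

theorem lact_pow_tmul (y a c : A) (n : ℕ) :
    (lactEnd φ y ^ n) (tmul φ a c) = tmul φ (y ^ n * a) c := by
  induction n generalizing a with
  | zero => rw [pow_zero, pow_zero, one_mul]; rfl
  | succ n ih =>
    rw [pow_succ, AddMonoid.End.mul_apply']
    exact (ih (y * a)).trans (by rw [pow_succ, mul_assoc])

theorem ract_pow_tmul (y a c : A) (n : ℕ) :
    (ractEnd φ y ^ n) (tmul φ a c) = tmul φ a (c * y ^ n) := by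
  induction n generalizing c with
  | zero => rw [pow_zero, pow_zero, mul_one]; rfl
  | succ n ih =>
    rw [pow_succ, AddMonoid.End.mul_apply']
    exact (ih (c * y)).trans (by rw [pow_succ', mul_assoc])

theorem tensorCommOp_pow_tmul (H : IsPPolyExtension p e D b φ x) (a c : A) (n : ℕ) :
    (tensorCommOp φ x ^ p ^ n) (tmul φ a c) =
      tmul φ a (c * x ^ p ^ n) - tmul φ (x ^ p ^ n * a) c := by
  have hc : Commute (lactEnd φ x) (ractEnd φ x) :=
    AddMonoidHom.ext fun u => lact_ract φ x x u
  -- The tensor square is killed by p because `A` is.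
  have h0 : (p : AddMonoid.End (TensorSq φ)) = 0 := AddMonoid.End.natCast_eq_zero fun u => by
    have : p • AddMonoidHom.id (TensorSq φ) = 0 := tensorSq_hom_ext fun a c => by
      change p • tmulRight φ c a = 0
      rw [← map_nsmul, nsmul_eq_mul, H.cast_eq_zero, zero_mul, map_zero]
    exact DFunLike.congr_fun this u
  rw [tensorCommOp, hc.sub_pow_prime_pow H.prime h0, AddMonoid.End.sub_apply', lact_pow_tmul,
    ract_pow_tmul]

/-- The Casimir element is the trace formula lifted to A ⊗_B A: h becomes h ⊗ 1, and ad x becomes u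
↦ ux - xu. Multiplication maps it back to the trace of h. -/
theorem isSeparable_of_trace_eq_one (H : IsPPolyExtension p e D b φ x) {h : A}
    (hV : ∀ a, φ a * h = h * φ a) (h1 : trace p e b φ x h = 1) : IsSeparable φ := by
  -- Elements commuting with B are stable under u ↦ ux - xu: the two D(a) terms from exchanging a
  -- and x cancel.
  have hpow : ∀ n a, lact φ (φ a) ((tensorCommOp φ x ^ n) (tmul φ h 1)) =
      ract φ (φ a) ((tensorCommOp φ x ^ n) (tmul φ h 1)) := fun n => by
    induction n with
    | zero =>
      intro a
      change tmul φ (φ a * h) 1 = tmul φ h (1 * φ a)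
      rw [hV, mul_tmul, mul_one, one_mul]
    | succ n ih =>
      intro a
      rw [pow_succ', AddMonoid.End.mul_apply']
      generalize (tensorCommOp φ x ^ n) (tmul φ h 1) = u at ih
      rw [tensorCommOp_apply, map_sub, map_sub, ← lact_mul, H.comm_root, lact_add, lact_ract, ih,
        lact_mul, ih, ih, ← ract_mul, ← ract_mul, H.comm_root, ract_add, ← lact_ract]
      abel
  have hmul : ∀ n, mulMap φ ((tensorCommOp φ x ^ n) (tmul φ h 1)) = (commOp x ^ n) h := fun n => by
    induction n with
    | zero => exact mul_one h
    | succ n ih =>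
      rw [pow_succ', AddMonoid.End.mul_apply', tensorCommOp_apply, map_sub, mulMap_ract,
        mulMap_lact, ih, pow_succ', AddMonoid.End.mul_apply', commOp_apply]
  refine (isSeparable_iff_exists_casimir φ).2 ⟨∑ j ∈ Finset.range (e + 1),
    ract φ (φ (b (j + 1))) ((tensorCommOp φ x ^ (p ^ j - 1)) (tmul φ h 1)),
    H.casimir_of_generators (fun a => ?_) ?_, ?_⟩
  · rw [map_sum, map_sum]
    refine Finset.sum_congr rfl fun j hj => ?_
    rw [lact_ract, hpow, ← ract_mul, ← ract_mul, H.central j hj]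
  · rw [eq_comm, ← sub_eq_zero, ← tensorCommOp_apply, map_sum]
    -- After summation over j, the relation f(x) = 0 leaves -h ⊗ b_0 + b_0 h ⊗ 1, which is zero
    -- since h commutes with b_0.
    have h2 : ∀ j ∈ Finset.range (e + 1), tensorCommOp φ x (ract φ (φ (b (j + 1)))
        ((tensorCommOp φ x ^ (p ^ j - 1)) (tmul φ h 1))) =
        tmulLeft φ h (x ^ p ^ j * φ (b (j + 1))) -
          tmulRight φ 1 (x ^ p ^ j * φ (b (j + 1)) * h) := fun j hj => by
      have hq : p ^ j - 1 + 1 = p ^ j := Nat.sub_add_cancel (Nat.pow_pos H.prime.pos)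
      have h3 : ∀ u, tensorCommOp φ x (ract φ (φ (b (j + 1))) u) =
          ract φ (φ (b (j + 1))) (tensorCommOp φ x u) := fun u => by
        rw [tensorCommOp_apply, tensorCommOp_apply, map_sub, lact_ract, ← ract_mul, ← ract_mul,
          H.central j hj]
      rw [h3, ← AddMonoid.End.mul_apply', ← pow_succ', hq, H.tensorCommOp_pow_tmul, map_sub,
        ract_tmul, ract_tmul, one_mul]
      change _ = tmul φ h _ - tmul φ _ 1
      rw [mul_assoc _ _ h, ← H.central j hj h, ← mul_assoc, mul_tmul, one_mul, mul_one]
    rw [Finset.sum_congr rfl h2, Finset.sum_sub_distrib, ← map_sum, ← map_sum, ← Finset.sum_mul,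
      H.root_eq, map_neg, neg_mul, map_neg, hV]
    change -tmul φ h _ - -tmul φ _ 1 = 0
    rw [mul_tmul, mul_one, sub_self]
  · refine Eq.trans ?_ h1
    rw [map_sum, trace_apply]
    exact Finset.sum_congr rfl fun j _ => by rw [mulMap_ract, hmul]

/-- The dual basis identity for a Frobenius homomorphism `π`. -/
theorem sum_frobenius (H : IsPPolyExtension p e D b φ x) (hb : b (e + 1) = 1) {π : A →+ B}
    (hl : ∀ a y, π (φ a * y) = a * π y) (hr : ∀ y a, π (y * φ a) = π y * a)
    (h1 : π (x ^ (p ^ e - 1)) = 1) (h0 : ∀ k < p ^ e - 1, π (x ^ k) = 0) (c : A) :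
    ∑ j ∈ Finset.range (e + 1), (∑ k ∈ Finset.range (p ^ j),
      φ (π (c * x ^ k)) * x ^ (p ^ j - 1 - k)) * φ (b (j + 1)) = c := by
  -- Φ is the identity because it is left B-linear, commutes with right multiplication by x, and
  -- fixes 1.
  let Φ : A →+ A := AddMonoidHom.mk' (fun c => ∑ j ∈ Finset.range (e + 1),
    (∑ k ∈ Finset.range (p ^ j), φ (π (c * x ^ k)) * x ^ (p ^ j - 1 - k)) * φ (b (j + 1)))
    fun c d => by simp only [add_mul, map_add, Finset.sum_add_distrib]
  have hΦ : ∀ c, Φ c = ∑ j ∈ Finset.range (e + 1), (∑ k ∈ Finset.range (p ^ j),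
    φ (π (c * x ^ k)) * x ^ (p ^ j - 1 - k)) * φ (b (j + 1)) := fun c => rfl
  have hΦl : ∀ a y, Φ (φ a * y) = φ a * Φ y := fun a y => by
    simp only [hΦ, mul_assoc, hl, map_mul, Finset.mul_sum, Finset.sum_mul]
  have hΦx : ∀ y, Φ (y * x) = Φ y * x := fun y => by
    -- Replacing y by yx shifts k by one, leaving the two boundary terms k = p^j and k = 0. Summed
    -- over j, f(x) = 0 turns them into -π(y b_0) and π(y) b_0, which cancel.
    have h2 : ∀ j ∈ Finset.range (e + 1), (∑ k ∈ Finset.range (p ^ j),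
        φ (π (y * x * x ^ k)) * x ^ (p ^ j - 1 - k)) * φ (b (j + 1)) =
        (∑ k ∈ Finset.range (p ^ j), φ (π (y * x ^ k)) * x ^ (p ^ j - 1 - k)) * φ (b (j + 1)) * x +
        (φ (π (y * (x ^ p ^ j * φ (b (j + 1))))) - φ (π y) * (x ^ p ^ j * φ (b (j + 1)))) :=
      fun j hj => by
      obtain ⟨q, hq⟩ : ∃ q, p ^ j = q + 1 :=
        ⟨p ^ j - 1, (Nat.sub_add_cancel (Nat.pow_pos H.prime.pos)).symm⟩
      rw [← mul_assoc y, hr, map_mul, mul_assoc _ (φ (b (j + 1))), ← H.central j hj,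
        ← mul_assoc, ← mul_assoc, ← sub_mul, ← add_mul, hq, Finset.sum_range_succ,
        Finset.sum_range_succ']
      congr 1
      simp only [add_mul, Finset.sum_mul, mul_assoc, ← pow_succ', ← pow_succ, pow_zero, mul_one,
        Nat.add_sub_cancel, Nat.sub_self, Nat.sub_zero]
      have h3 : ∀ k ∈ Finset.range q, φ (π (y * x ^ (k + 1))) * x ^ (q - k) =
          φ (π (y * x ^ (k + 1))) * x ^ (q - (k + 1) + 1) := fun k hk => by
        have := Finset.mem_range.1 hk
        rw [show q - (k + 1) + 1 = q - k by omega]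
      rw [Finset.sum_congr rfl h3]
      abel
    rw [hΦ, Finset.sum_congr rfl h2, Finset.sum_add_distrib, ← Finset.sum_mul,
      Finset.sum_sub_distrib, ← map_sum, ← map_sum, ← Finset.mul_sum, ← Finset.mul_sum, H.root_eq,
      mul_neg, mul_neg, map_neg, map_neg, hr, map_mul, sub_self, add_zero, ← hΦ]
  -- Only j = e, k = p^e - 1 survives: every other exponent k is below p^e - 1, where π vanishes.
  have hΦ1 : Φ 1 = 1 := by
    rw [hΦ, Finset.sum_range_succ, Finset.sum_eq_zero, zero_add, hb, map_one, mul_one]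
    · obtain ⟨q, hq⟩ : ∃ q, p ^ e = q + 1 :=
        ⟨p ^ e - 1, (Nat.sub_add_cancel (Nat.pow_pos H.prime.pos)).symm⟩
      rw [hq, Nat.add_sub_cancel] at h1 h0
      rw [hq, Finset.sum_range_succ, Finset.sum_eq_zero, one_mul, h1]
      · simp
      · intro k hk
        rw [one_mul, h0 k (Finset.mem_range.1 hk), map_zero, zero_mul]
    · intro j hj
      rw [Finset.sum_eq_zero, zero_mul]
      intro k hk
      have h4 : p ^ j < p ^ e := Nat.pow_lt_pow_right H.prime.one_lt (Finset.mem_range.1 hj)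
      have := Finset.mem_range.1 hk
      rw [one_mul, h0 k (by omega), map_zero, zero_mul]
  refine H.generates_left (S := Φ.eqLocus (AddMonoidHom.id A)) (fun a l => ?_) c
  change Φ (φ a * x ^ l) = φ a * x ^ l
  rw [hΦl]
  congr 1
  induction l with
  | zero => rw [pow_zero, hΦ1]
  | succ l ih => rw [pow_succ, hΦx, ih]

/-- The witness is h = (id ⊗ π)(t) for a Casimir element t of product 1; it centralizes B because π
is right B-linear. -/
theorem exists_trace_eq_one (H : IsPPolyExtension p e D b φ x) (hb : b (e + 1) = 1) {π : A →+ B}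
    (hl : ∀ a y, π (φ a * y) = a * π y) (hr : ∀ y a, π (y * φ a) = π y * a)
    (h1 : π (x ^ (p ^ e - 1)) = 1) (h0 : ∀ k < p ^ e - 1, π (x ^ k) = 0) (hs : IsSeparable φ) :
    ∃ h, (∀ a, φ a * h = h * φ a) ∧ trace p e b φ x h = 1 := by
  obtain ⟨t, ht, ht1⟩ := (isSeparable_iff_exists_casimir φ).1 hs
  let G : TensorSq φ →+ A := tensorSqLift φ
    ((AddMonoidHom.mul (R := A)).compr₂ (AddMonoidHom.id A) |>.compl₂ (φ.toAddMonoidHom.comp π))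
    fun a c d => by
      change a * φ d * φ (π c) = a * φ (π (φ d * c))
      rw [hl, map_mul, mul_assoc]
  have hG : ∀ a c, G (tmul φ a c) = a * φ (π c) := fun a c => rfl
  have hGl : ∀ y u, G (lact φ y u) = y * G u := fun y u =>
    DFunLike.congr_fun (tensorSq_hom_ext (F := G.comp (lact φ y))
      (G := (AddMonoidHom.mulLeft y).comp G)
      fun a c => by simp [lact_tmul, hG, mul_assoc]) u
  have hGr : ∀ a u, G (ract φ (φ a) u) = G u * φ a := fun a u =>
    DFunLike.congr_fun (tensorSq_hom_ext (F := G.comp (ract φ (φ a)))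
      (G := (AddMonoidHom.mulRight (φ a)).comp G)
      fun a c => by simp [ract_tmul, hG, mul_assoc, hr]) u
  refine ⟨G t, fun a => by rw [← hGl, ht, hGr], ?_⟩
  -- The dual basis identity in the second tensor factor. At t, the Casimir property gives G(t x^k)
  -- = x^k G(t), so the left side becomes the trace of h.
  have key : ∑ j ∈ Finset.range (e + 1), (AddMonoidHom.mulRight (φ (b (j + 1)))).comp
      (∑ k ∈ Finset.range (p ^ j), (AddMonoidHom.mulRight (x ^ (p ^ j - 1 - k))).comp
        (G.comp (ract φ (x ^ k)))) = mulMap φ := tensorSq_hom_ext fun a c => by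
    rw [mulMap_tmul]
    conv_rhs => rw [← H.sum_frobenius hb hl hr h1 h0 c]
    simp only [AddMonoidHom.finsetSum_apply, AddMonoidHom.comp_apply, AddMonoidHom.mulRight_apply,
      ract_tmul, hG, Finset.mul_sum, Finset.sum_mul, mul_assoc]
  have := DFunLike.congr_fun key t
  rw [ht1] at this
  rw [← this, H.trace_eq_sum]
  simp only [AddMonoidHom.finsetSum_apply, AddMonoidHom.comp_apply, AddMonoidHom.mulRight_apply,
    ← ht, hGl]

end IsPPolyExtension

/-! ### Powers of the indeterminate against constants in characteristic p -/

namespace DiffPoly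

variable {B : Type*} [Ring B] {D : RingDerivation B}

theorem shift_eq_X_mul (g : DiffPoly D) : shift g = X * g := by
  have h1 : (X : DiffPoly D) = shift 1 := by rw [one_def, shift_monomial]; rfl
  rw [h1, shift_mul', one_mul]

theorem C_eq_monomial (a : B) : (C a : DiffPoly D) = monomial 0 a := rfl

theorem natCast_eq_zero (p : ℕ) [CharP B p] : (p : DiffPoly D) = 0 := by
  rw [← map_natCast (C : B →+* DiffPoly D), CharP.cast_eq_zero, map_zero]

theorem commOp_X_pow_C (n : ℕ) (a : B) :
    (commOp (X : DiffPoly D) ^ n) (C a) = C (D^[n] a) := by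
  induction n with
  | zero => rfl
  | succ n ih =>
    rw [pow_succ', AddMonoid.End.mul_apply', ih, Function.iterate_succ_apply', commOp_apply,
      C_mul_X, add_sub_cancel_left]

theorem C_mul_X_pow_prime_pow {p : ℕ} (hp : p.Prime) [CharP B p] (n : ℕ) (a : B) :
    (C a * X ^ p ^ n : DiffPoly D) = X ^ p ^ n * C a + C (D^[p ^ n] a) := by
  rw [← commOp_X_pow_C, commOp_pow_apply hp (natCast_eq_zero p), add_sub_cancel]

/-! ### `p`-polynomials -/

variable (D) in
/-- The `p`-polynomial `∑ j ≤ e, X ^ (p ^ j) * c j + c₀`. -/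
noncomputable def pPoly (p e : ℕ) (c : ℕ → B) (c₀ : B) : DiffPoly D :=
  ∑ j ∈ Finset.range (e + 1), (X : DiffPoly D) ^ p ^ j * C (c j) + C c₀

theorem coeff_pPoly {p : ℕ} (hp : p.Prime) {e i : ℕ} (hi : i ∈ Finset.range (e + 1)) (c : ℕ → B)
    (c₀ : B) : (pPoly D p e c c₀).coeff (p ^ i) = c i := by
  rw [pPoly, coeff_add, coeff_sum, C_eq_monomial, coeff_monomial,
    if_neg (Nat.pow_pos hp.pos).ne, add_zero, Finset.sum_eq_single_of_mem i hi]
  · rw [X_pow_mul_C, coeff_monomial, if_pos rfl]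
  · intro j _ hj
    rw [X_pow_mul_C, coeff_monomial, if_neg fun h => hj (Nat.pow_right_injective hp.two_le h)]

theorem pPoly_mem_degreeLT {p : ℕ} (hp : p.Prime) (e : ℕ) (c : ℕ → B) (c₀ : B) :
    pPoly D p e c c₀ ∈ degreeLT D (p ^ e + 1) := by
  refine add_mem (sum_mem fun j hj => ?_) (monomial_mem_degreeLT (Nat.succ_pos _) c₀)
  rw [X_pow_mul_C]
  exact monomial_mem_degreeLT (Nat.lt_succ_of_le (Nat.pow_le_pow_right hp.pos
    (Nat.le_of_lt_succ (Finset.mem_range.1 hj)))) _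

theorem mapCoeff_pPoly (p e : ℕ) (c : ℕ → B) (c₀ : B) :
    mapCoeff (pPoly D p e c c₀) = pPoly D p e (fun j => D (c j)) (D c₀) := by
  simp only [pPoly, map_add, map_sum, X_pow_mul_C, mapCoeff_monomial]
  rw [C_eq_monomial, C_eq_monomial, mapCoeff_monomial]

/-- Moving a past X^(p^j) produces a constant as its only correction, so the commutator is again a
p-polynomial. -/
theorem C_mul_pPoly_sub {p : ℕ} (hp : p.Prime) [CharP B p] (e : ℕ) (c : ℕ → B) (c₀ a : B) :
    C a * pPoly D p e c c₀ - pPoly D p e c c₀ * C a =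
      pPoly D p e (fun j => a * c j - c j * a)
        (∑ j ∈ Finset.range (e + 1), D^[p ^ j] a * c j + (a * c₀ - c₀ * a)) := by
  simp only [pPoly, mul_add, add_mul, Finset.mul_sum, Finset.sum_mul, ← mul_assoc,
    C_mul_X_pow_prime_pow hp, map_add, map_sub, map_mul, map_sum, mul_sub,
    Finset.sum_add_distrib, Finset.sum_sub_distrib]
  abel

theorem eq_zero_of_mem_idealOf {f : invariantMonics D} {m : ℕ}
    (hf : (f : DiffPoly D) ∈ degreeLT D (m + 1)) (hm : (f : DiffPoly D).coeff m = 1)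
    {g : DiffPoly D} (hg : g ∈ idealOf f) (hd : g ∈ degreeLT D m) : g = 0 := by
  obtain ⟨q, rfl⟩ := hg
  rw [eq_zero_of_mul_mem_degreeLT hf hm hd, mul_zero]

theorem self_mem_idealOf (f : invariantMonics D) : (f : DiffPoly D) ∈ idealOf f :=
  ⟨1, (mul_one _).symm⟩

/-- The class of the indeterminate in the residue ring. -/
noncomputable def root (f : invariantMonics D) : ResidueRing f := Ideal.Quotient.mk (idealOf f) X

theorem toResidue_apply (f : invariantMonics D) (a : B) :
    toResidue f a = Ideal.Quotient.mk (idealOf f) (C a) := rfl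

theorem toResidue_mul_root (f : invariantMonics D) (a : B) :
    toResidue f a * root f = root f * toResidue f a + toResidue f (D a) := by
  simp only [toResidue_apply, root, ← map_mul, ← map_add, C_mul_X]

theorem inducedDerivation_eq_commOp (f : invariantMonics D) (y : ResidueRing f) :
    inducedDerivation f y = commOp (root f) y := by
  obtain ⟨g, rfl⟩ := Ideal.Quotient.mk_surjective y
  rw [inducedDerivation_mk, mapCoeff_eq, map_sub, map_mul, map_mul]
  rfl

theorem inducedDerivation_iterate (f : invariantMonics D) (n : ℕ) (y : ResidueRing f) :
    (inducedDerivation f)^[n] y = (commOp (root f) ^ n) y := by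
  induction n with
  | zero => rfl
  | succ n ih =>
    rw [Function.iterate_succ_apply', ih, inducedDerivation_eq_commOp, pow_succ']
    rfl

theorem residue_generates (f : invariantMonics D) (S : AddSubgroup (ResidueRing f))
    (hB : ∀ a, toResidue f a ∈ S) (hx : ∀ y ∈ S, root f * y ∈ S) (y : ResidueRing f) : y ∈ S := by
  obtain ⟨g, rfl⟩ := Ideal.Quotient.mk_surjective y
  induction g using ind with
  | h0 a => exact hB a
  | hS g ih => rw [shift_eq_X_mul, map_mul]; exact hx _ ih
  | hadd g h hg hh => rw [map_add]; exact add_mem hg hh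

/-- Both fX - Xf and af - fa are p-polynomials in the two-sided ideal of f. Their coefficient at
X^(p^e) vanishes because f is monic, so their degree is too small for them to be nonzero. -/
theorem coeff_properties {p : ℕ} (hp : p.Prime) [CharP B p] {e : ℕ} {b : ℕ → B}
    (hb : b (e + 1) = 1) {f : invariantMonics D}
    (hf : (f : DiffPoly D) = pPoly D p e (fun j => b (j + 1)) (b 0)) {j : ℕ}
    (hj : j ∈ Finset.range (e + 1)) :
    D (b (j + 1)) = 0 ∧ ∀ a, a * b (j + 1) = b (j + 1) * a := by
  have he : e ∈ Finset.range (e + 1) := Finset.self_mem_range_succ e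
  have hfd : (f : DiffPoly D) ∈ degreeLT D (p ^ e + 1) := hf ▸ pPoly_mem_degreeLT hp _ _ _
  have hfm : (f : DiffPoly D).coeff (p ^ e) = 1 := by rw [hf, coeff_pPoly hp he, hb]
  have key : ∀ (c : ℕ → B) (c₀ : B), c e = 0 → pPoly D p e c c₀ ∈ idealOf f → c j = 0 := by
    intro c c₀ hc hmem
    have h0 := eq_zero_of_mem_idealOf hfd hfm hmem
      (mem_degreeLT_of_succ (pPoly_mem_degreeLT hp _ _ _) (by rw [coeff_pPoly hp he, hc]))
    rw [← coeff_pPoly (D := D) hp hj c c₀, h0, coeff_zero]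
  constructor
  · refine key (fun j => D (b (j + 1))) (D (b 0)) (by simp only [hb, D.map_one_eq_zero]) ?_
    rw [← mapCoeff_pPoly, ← hf]
    exact mapCoeff_mem (self_mem_idealOf f)
  · intro a
    refine sub_eq_zero.1 (key (fun j => a * b (j + 1) - b (j + 1) * a)
      (∑ j ∈ Finset.range (e + 1), D^[p ^ j] a * b (j + 1) + (a * b 0 - b 0 * a))
      (by simp only [hb, mul_one, one_mul, sub_self]) ?_)
    rw [← C_mul_pPoly_sub hp, ← hf]
    exact sub_mem ((idealOf f).mul_mem_left _ (self_mem_idealOf f))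
      ((idealOf f).mul_mem_right _ (self_mem_idealOf f))

theorem isPPolyExtension {p : ℕ} (hp : p.Prime) [CharP B p] {e : ℕ} {b : ℕ → B}
    (hb : b (e + 1) = 1) {f : invariantMonics D}
    (hf : (f : DiffPoly D) = pPoly D p e (fun j => b (j + 1)) (b 0)) :
    IsPPolyExtension p e D b (toResidue f) (root f) where
  prime := hp
  cast_eq_zero := by
    rw [← map_natCast (Ideal.Quotient.mk (idealOf f)), natCast_eq_zero, map_zero]
  comm_root := toResidue_mul_root f
  root := by
    have := Ideal.Quotient.eq_zero_iff_mem.2 (self_mem_idealOf f)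
    rw [hf, pPoly] at this
    simpa only [root, toResidue_apply, map_add, map_sum, map_mul, map_pow] using this
  central := by
    intro j hj y
    obtain ⟨hD, hc⟩ := coeff_properties hp hb hf hj
    have := residue_generates f ((AddMonoidHom.mulRight (toResidue f (b (j + 1)))).eqLocus
      (AddMonoidHom.mulLeft (toResidue f (b (j + 1))))) (fun a => ?_) (fun y hy => ?_) y
    · exact this
    · change toResidue f a * toResidue f (b (j + 1)) = toResidue f (b (j + 1)) * toResidue f a
      rw [← map_mul, hc, map_mul]
    · change root f * y * toResidue f (b (j + 1)) = toResidue f (b (j + 1)) * (root f * y)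
      have hy : y * toResidue f (b (j + 1)) = toResidue f (b (j + 1)) * y := hy
      rw [mul_assoc, hy, ← mul_assoc, ← mul_assoc, toResidue_mul_root, hD, map_zero, add_zero]
  generates := residue_generates f

/-! ### The Frobenius homomorphism of a residue ring -/

section Frobenius

variable {f : invariantMonics D} {n : ℕ}

theorem exists_mk_eq (hf : (f : DiffPoly D) ∈ degreeLT D (n + 1 + 1))
    (hm : (f : DiffPoly D).coeff (n + 1) = 1) (y : ResidueRing f) :
    ∃ r ∈ degreeLT D (n + 1), Ideal.Quotient.mk (idealOf f) r = y := by
  obtain ⟨g, rfl⟩ := Ideal.Quotient.mk_surjective y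
  obtain ⟨q, r, hr, rfl⟩ := exists_eq_mul_add hf hm g
  exact ⟨r, hr, Ideal.Quotient.eq.2 ⟨-q, by rw [mul_neg]; abel⟩⟩

theorem eq_of_mk_eq (hf : (f : DiffPoly D) ∈ degreeLT D (n + 1 + 1))
    (hm : (f : DiffPoly D).coeff (n + 1) = 1)
    {r s : DiffPoly D} (hr : r ∈ degreeLT D (n + 1)) (hs : s ∈ degreeLT D (n + 1))
    (h : Ideal.Quotient.mk (idealOf f) r = Ideal.Quotient.mk (idealOf f) s) : r = s :=
  sub_eq_zero.1 (eq_zero_of_mem_idealOf hf hm (Ideal.Quotient.eq.1 h) (sub_mem hr hs))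

/-- Here f has degree n + 1, and π reads the coefficient of X^n in the reduced representative.
Multiplying by a constant on either side keeps a representative reduced and multiplies that
coefficient. -/
theorem exists_frobenius (hf : (f : DiffPoly D) ∈ degreeLT D (n + 1 + 1))
    (hm : (f : DiffPoly D).coeff (n + 1) = 1) :
    ∃ π : ResidueRing f →+ B,
    (∀ a y, π (toResidue f a * y) = a * π y) ∧ (∀ y a, π (y * toResidue f a) = π y * a) ∧
      π (root f ^ n) = 1 ∧ ∀ k < n, π (root f ^ k) = 0 := by
  choose rep hrep hmk using exists_mk_eq hf hm
  have huniq : ∀ y, ∀ r ∈ degreeLT D (n + 1), Ideal.Quotient.mk (idealOf f) r = y → rep y = r :=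
    fun y r hr h => eq_of_mk_eq hf hm (hrep y) hr ((hmk y).trans h.symm)
  have hpow : ∀ k ≤ n, rep (root f ^ k) = monomial k 1 := fun k hk => by
    refine huniq _ _ (monomial_mem_degreeLT (Nat.lt_succ_of_le hk) 1) ?_
    rw [← X_pow_mul_C, map_one, mul_one, map_pow]
    rfl
  refine ⟨AddMonoidHom.mk' (fun y => (rep y).coeff n) fun y z => ?_, fun a y => ?_, fun y a => ?_,
    ?_, fun k hk => ?_⟩
  · rw [huniq (y + z) (rep y + rep z) (add_mem (hrep y) (hrep z)) (by rw [map_add, hmk, hmk]),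
      coeff_add]
  · change (rep (toResidue f a * y)).coeff n = a * (rep y).coeff n
    have h := const_mul_mem_degreeLT (hrep y) a
    rw [huniq _ _ h.1 (by rw [map_mul, hmk]; rfl), h.2]
  · change (rep (y * toResidue f a)).coeff n = (rep y).coeff n * a
    have h := mul_mem_degreeLT (hrep y) (monomial_mem_degreeLT (D := D) Nat.zero_lt_one a)
    rw [huniq _ _ h.1 (by rw [map_mul, hmk]; rfl)]
    exact h.2.trans (by rw [coeff_monomial, if_pos rfl])
  · change (rep (root f ^ n)).coeff n = 1
    rw [hpow n le_rfl, coeff_monomial, if_pos rfl]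
  · change (rep (root f ^ k)).coeff n = 0
    rw [hpow k hk.le, coeff_monomial, if_neg hk.ne]

end Frobenius

/-! ### Derivations of a residue ring -/

section Derivations

variable (f : invariantMonics D) (v : ResidueRing f)

/-- The additive map `X ^ i * a ↦ (∑ k < i, x ^ k * v * x ^ (i - 1 - k)) * a`. -/
noncomputable def derivLift : DiffPoly D →+ ResidueRing f :=
  lift fun i => (AddMonoidHom.mulLeft (∑ k ∈ Finset.range i,
    root f ^ k * v * root f ^ (i - 1 - k))).comp (toResidue f).toAddMonoidHom

theorem derivLift_monomial (i : ℕ) (a : B) : derivLift f v (monomial i a) =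
    (∑ k ∈ Finset.range i, root f ^ k * v * root f ^ (i - 1 - k)) * toResidue f a :=
  lift_monomial _ i a

theorem mk_monomial (i : ℕ) (a : B) :
    Ideal.Quotient.mk (idealOf f) (monomial i a) = root f ^ i * toResidue f a := by
  rw [← X_pow_mul_C, map_mul, map_pow]
  rfl

theorem derivLift_const (a : B) : derivLift f v (monomial 0 a) = 0 := by
  rw [derivLift_monomial, Finset.range_zero, Finset.sum_empty, zero_mul]

theorem derivLift_shift (g : DiffPoly D) : derivLift f v (shift g) =
    v * Ideal.Quotient.mk (idealOf f) g + root f * derivLift f v g := by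
  have : (derivLift f v).comp shift = (AddMonoidHom.mulLeft v).comp
      (Ideal.Quotient.mk (idealOf f)).toAddMonoidHom +
      (AddMonoidHom.mulLeft (root f)).comp (derivLift f v) := hom_ext fun i a => by
    change derivLift f v (shift (monomial i a)) = v * Ideal.Quotient.mk (idealOf f) (monomial i a) +
      root f * derivLift f v (monomial i a)
    rw [shift_monomial, derivLift_monomial, derivLift_monomial, mk_monomial, ← mul_assoc,
      ← mul_assoc, ← add_mul, Finset.sum_range_succ', Finset.mul_sum, add_comm]
    congr 2
    · simp
    · refine Finset.sum_congr rfl fun k _ => ?_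
      rw [pow_succ', show i + 1 - 1 - (k + 1) = i - 1 - k by omega]
      simp only [mul_assoc]
  exact DFunLike.congr_fun this g

variable {f v} in
-- This is where v must centralize B: differentiating aX = Xa + D(a) along v gives av = va.
theorem derivLift_const_mul (hv : ∀ a, toResidue f a * v = v * toResidue f a) (a : B)
    (g : DiffPoly D) : derivLift f v (monomial 0 a * g) = toResidue f a * derivLift f v g := by
  induction g using ind generalizing a with
  | h0 c =>
    rw [← C_eq_monomial, ← C_eq_monomial, ← map_mul, C_eq_monomial, C_eq_monomial,
      derivLift_const, derivLift_const, mul_zero]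
  | hS g ih =>
    have h1 : monomial 0 a * shift g = shift (monomial 0 a * g) + monomial 0 (D a) * g :=
      const_mul_shift a g
    rw [h1, map_add, derivLift_shift, derivLift_shift, ih, ih, map_mul, ← C_eq_monomial,
      ← toResidue_apply, mul_add, ← mul_assoc v, ← hv, ← mul_assoc (toResidue f a) (root f),
      toResidue_mul_root]
    noncomm_ring
  | hadd g h hg hh => rw [mul_add, map_add, hg, hh, map_add, mul_add]

variable {f v} in
theorem derivLift_mul (hv : ∀ a, toResidue f a * v = v * toResidue f a) (g h : DiffPoly D) :
    derivLift f v (g * h) = derivLift f v g * Ideal.Quotient.mk (idealOf f) h +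
      Ideal.Quotient.mk (idealOf f) g * derivLift f v h := by
  induction g using ind with
  | h0 a => rw [derivLift_const_mul hv, derivLift_const, zero_mul, zero_add]; rfl
  | hS g ih =>
    have hx : Ideal.Quotient.mk (idealOf f) (shift g) =
        root f * Ideal.Quotient.mk (idealOf f) g := by rw [shift_eq_X_mul, map_mul]; rfl
    rw [shift_mul', derivLift_shift, ih, derivLift_shift, hx, map_mul]
    noncomm_ring
  | hadd g k hg hk => rw [add_mul, map_add, hg, hk, map_add, map_add]; noncomm_ring

variable {f v} in
/-- A `B`-derivation of the residue ring with a prescribed value `v` at the root exists as soon as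
`v` centralizes `B` and the formal derivative of `f` along `v` vanishes. -/
theorem exists_derivation (hv : ∀ a, toResidue f a * v = v * toResidue f a)
    (h0 : derivLift f v f = 0) :
    ∃ δ : RingDerivation (ResidueRing f), (∀ a, δ (toResidue f a) = 0) ∧ δ (root f) = v := by
  -- By the Leibniz rule the value on f q is a multiple of the value on f plus a multiple of the
  -- class of f, both zero.
  have hker : ∀ g ∈ (idealOf f).toAddSubgroup, derivLift f v g = 0 := by
    rintro _ ⟨q, rfl⟩
    rw [derivLift_mul hv, h0, zero_mul, zero_add,
      Ideal.Quotient.eq_zero_iff_mem.2 (self_mem_idealOf f), zero_mul]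
  refine ⟨⟨QuotientAddGroup.lift (idealOf f).toAddSubgroup (derivLift f v) hker, fun y z => ?_⟩,
    fun a => derivLift_const f v a, ?_⟩
  · obtain ⟨g, rfl⟩ := Ideal.Quotient.mk_surjective y
    obtain ⟨h, rfl⟩ := Ideal.Quotient.mk_surjective z
    exact derivLift_mul hv g h
  · change derivLift f v (monomial 1 1) = v
    rw [derivLift_monomial]
    simp

end Derivations

end DiffPoly

/-! ### Values of B-derivations at the root -/

theorem RingDerivation.map_pow_eq_sum {A : Type*} [Ring A] (δ : RingDerivation A) (x : A) (n : ℕ) :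
    δ (x ^ n) = ∑ k ∈ Finset.range n, x ^ k * δ x * x ^ (n - 1 - k) := by
  induction n with
  | zero => simp [δ.map_one_eq_zero]
  | succ n ih =>
    rw [pow_succ', δ.leibniz, ih, Finset.sum_range_succ', Finset.mul_sum, add_comm]
    congr 1
    · refine Finset.sum_congr rfl fun k _ => ?_
      rw [pow_succ', show n + 1 - 1 - (k + 1) = n - 1 - k by omega]
      simp only [mul_assoc]
    · simp

namespace IsPPolyExtension

variable {A B : Type*} [Ring A] [Ring B] {p e : ℕ} {D : RingDerivation B} {b : ℕ → B}
  {φ : B →+* A} {x : A}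

/-- Applying δ to f(x) = 0 gives exactly the trace of δ(x), since the coefficients are killed. -/
theorem trace_derivation_root (H : IsPPolyExtension p e D b φ x) {δ : RingDerivation A}
    (hδ : ∀ a, δ (φ a) = 0) : trace p e b φ x (δ x) = 0 := by
  have := congrArg δ H.root
  rw [map_add, map_sum, hδ, add_zero, map_zero] at this
  rw [H.trace_eq_sum, ← this]
  exact Finset.sum_congr rfl fun j _ => by rw [δ.leibniz, hδ, mul_zero, add_zero, δ.map_pow_eq_sum]

theorem derivation_root_comm (H : IsPPolyExtension p e D b φ x) {δ : RingDerivation A}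
    (hδ : ∀ a, δ (φ a) = 0) (a : B) : φ a * δ x = δ x * φ a := by
  have := congrArg δ (H.comm_root a)
  simpa [δ.leibniz, hδ] using this

theorem derivation_eq_inner (H : IsPPolyExtension p e D b φ x) {δ : RingDerivation A}
    (hδ : ∀ a, δ (φ a) = 0) {m : A} (hm : ∀ a, φ a * m = m * φ a) (hx : δ x = commOp x m) (y : A) :
    δ y = m * y - y * m := by
  have := H.generates (δ.toAddMonoidHom.eqLocus
    (AddMonoidHom.mulLeft m - AddMonoidHom.mulRight m)) (fun a => ?_) (fun y hy => ?_) y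
  · exact this
  · change δ (φ a) = m * φ a - φ a * m
    rw [hδ, hm, sub_self]
  · change δ (x * y) = m * (x * y) - x * y * m
    have hy : δ y = m * y - y * m := hy
    rw [δ.leibniz, hy, hx, commOp_apply]
    noncomm_ring

end IsPPolyExtension

/-! ### The sequence of the centralizer V and its exactness -/

namespace DiffPoly

variable {B : Type*} [Ring B] {D : RingDerivation B} {f : invariantMonics D}

theorem mem_V {y : ResidueRing f} :
    y ∈ V f ↔ ∀ a, toResidue f a * y = y * toResidue f a := by
  rw [V, Subring.mem_centralizer_iff, Set.forall_mem_range]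

theorem mem_VD {y : ResidueRing f} : y ∈ VD f ↔ y ∈ V f ∧ commOp (root f) y = 0 := by
  rw [← inducedDerivation_eq_commOp]
  rfl

theorem coe_derivV (h : V f) : (derivV f h : ResidueRing f) = commOp (root f) h :=
  inducedDerivation_eq_commOp f h

theorem coe_inj (s : VD f) : (inj f s : ResidueRing f) = s := rfl

theorem inj_injective (f : invariantMonics D) : Function.Injective (inj f) :=
  Subring.inclusion_injective _

theorem exact_inj_derivV (f : invariantMonics D) : Function.Exact (inj f) (derivV f) := by
  intro h
  constructor
  · intro h0
    refine ⟨⟨h, mem_VD.2 ⟨h.2, ?_⟩⟩, rfl⟩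
    rw [← coe_derivV, h0, ZeroMemClass.coe_zero]
  · rintro ⟨s, rfl⟩
    exact Subtype.ext (by rw [coe_derivV, coe_inj, (mem_VD.1 s.2).2, ZeroMemClass.coe_zero])

variable {p e : ℕ} {b : ℕ → B}

open IsPPolyExtension in
theorem trace_mem_VD (H : IsPPolyExtension p e D b (toResidue f) (root f)) {h : ResidueRing f}
    (hh : h ∈ V f) : trace p e b (toResidue f) (root f) h ∈ VD f := by
  refine mem_VD.2 ⟨?_, H.commOp_trace (mem_V.1 hh _)⟩
  have hn : ∀ n, (commOp (root f) ^ n) h ∈ V f := fun n => by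
    induction n with
    | zero => exact hh
    | succ n ih =>
      rw [pow_succ', AddMonoid.End.mul_apply', ← inducedDerivation_eq_commOp]
      exact inducedDerivation_mem_V ih
  rw [trace_apply]
  exact sum_mem fun j hj => mul_mem (hn _) (mem_V.2 fun a => H.central j hj _)

open IsPPolyExtension in
/-- The map `τ : V → V^D̃`. -/
noncomputable def traceV (H : IsPPolyExtension p e D b (toResidue f) (root f)) : V f →+ VD f :=
  ((trace p e b (toResidue f) (root f)).comp (V f).subtype.toAddMonoidHom).codRestrict (VD f)
    fun h => trace_mem_VD H h.2

open IsPPolyExtension in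
theorem coe_traceV (H : IsPPolyExtension p e D b (toResidue f) (root f)) (h : V f) :
    (traceV H h : ResidueRing f) = trace p e b (toResidue f) (root f) h := rfl

theorem traceV_eq_zero_iff (H : IsPPolyExtension p e D b (toResidue f) (root f)) (h : V f) :
    traceV H h = 0 ↔ IsPPolyExtension.trace p e b (toResidue f) (root f) h = 0 := by
  rw [← coe_traceV H, ZeroMemClass.coe_eq_zero]

theorem traceV_mul_mul (H : IsPPolyExtension p e D b (toResidue f) (root f)) (s t : VD f)
    (h : V f) : traceV H (inj f s * h * inj f t) = s * traceV H h * t :=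
  Subtype.ext (H.trace_mul_mul (mem_VD.1 s.2).2 (mem_VD.1 t.2).2 h)

theorem isWeaklySeparablePoly_iff (H : IsPPolyExtension p e D b (toResidue f) (root f))
    (hf : (f : DiffPoly D) = pPoly D p e (fun j => b (j + 1)) (b 0)) :
    IsWeaklySeparablePoly f ↔ Function.Exact (derivV f) (traceV H) := by
  constructor
  · intro hw h
    constructor
    · intro h0
      rw [traceV_eq_zero_iff, H.trace_eq_sum] at h0
      have hd : derivLift f h f = 0 := by
        rw [← h0, hf, pPoly, map_add, map_sum, C_eq_monomial, derivLift_const, add_zero]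
        exact Finset.sum_congr rfl fun j _ => by rw [X_pow_mul_C, derivLift_monomial]
      obtain ⟨δ, hδ, hδx⟩ := exists_derivation (mem_V.1 h.2) hd
      obtain ⟨m, hm⟩ := hw δ hδ
      -- The inner derivation of m kills B, so m lies in V; its value at x is D̃(m).
      refine ⟨⟨m, mem_V.2 fun a => ?_⟩, Subtype.ext ?_⟩
      · have := hm (toResidue f a)
        rw [hδ, eq_comm, sub_eq_zero] at this
        exact this.symm
      · rw [coe_derivV, ← hδx, hm, commOp_apply]
    · rintro ⟨g, rfl⟩
      rw [traceV_eq_zero_iff, coe_derivV, H.trace_commOp (mem_V.1 g.2 _)]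
  · intro hex δ hδ
    obtain ⟨m, hm⟩ := (hex ⟨δ (root f), mem_V.2 (H.derivation_root_comm hδ)⟩).1
      ((traceV_eq_zero_iff H _).2 (H.trace_derivation_root hδ))
    refine ⟨m, H.derivation_eq_inner hδ (mem_V.1 m.2) ?_⟩
    rw [← coe_derivV, hm]

theorem isSeparablePoly_iff_surjective (H : IsPPolyExtension p e D b (toResidue f) (root f))
    (hb : b (e + 1) = 1) (hf : (f : DiffPoly D) = pPoly D p e (fun j => b (j + 1)) (b 0)) :
    IsSeparablePoly f ↔ Function.Surjective (traceV H) := by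
  constructor
  · intro hs
    have hq : p ^ e - 1 + 1 = p ^ e := Nat.sub_add_cancel (Nat.pow_pos H.prime.pos)
    obtain ⟨π, hl, hr, h1, h0⟩ := exists_frobenius (f := f) (n := p ^ e - 1)
      (by rw [hq, hf]; exact pPoly_mem_degreeLT H.prime _ _ _)
      (by rw [hq, hf, coeff_pPoly H.prime (Finset.self_mem_range_succ e), hb])
    obtain ⟨h, hV, ht⟩ := H.exists_trace_eq_one hb hl hr h1 h0 hs
    intro s
    -- Linearity over V^D̃ turns τ(h) = 1 into τ(sh) = s; the factor 1 only fits the two-sided form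
    -- of that lemma.
    refine ⟨inj f s * ⟨h, mem_V.2 hV⟩ * inj f 1, ?_⟩
    rw [traceV_mul_mul, mul_one]
    refine Subtype.ext ?_
    rw [Subring.coe_mul, coe_traceV, ht, mul_one]
  · intro hs
    obtain ⟨h, hh⟩ := hs 1
    refine H.isSeparable_of_trace_eq_one (mem_V.1 h.2) ?_
    rw [← coe_traceV H, hh, Subring.coe_one]

end DiffPoly

open DiffPoly in
theorem mainTheorem5 {B : Type*} [Ring B] (p : ℕ) [Fact p.Prime] [CharP B p]
    (D : RingDerivation B) (e : ℕ) (b : ℕ → B) (hb : b (e + 1) = 1)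
    (f : invariantMonics D)
    (hf : (f : DiffPoly D) =
      ∑ j ∈ Finset.range (e + 1), (X : DiffPoly D) ^ (p ^ j) * C (b (j + 1)) + C (b 0)) :
    -- the map `τ : V → V^D̃` is well defined by its formula
    ∃ τ : V f →+ VD f,
      (∀ h : V f, (τ h : ResidueRing f) =
        ∑ j ∈ Finset.range (e + 1),
          (inducedDerivation f)^[p ^ j - 1] (h : ResidueRing f) * toResidue f (b (j + 1))) ∧
      -- the maps are `V^D̃`-`V^D̃`-homomorphisms
      (∀ s v t : VD f, inj f (s * v * t) = inj f s * inj f v * inj f t) ∧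
      (∀ (s t : VD f) (h : V f), derivV f (inj f s * h * inj f t) =
        inj f s * derivV f h * inj f t) ∧
      (∀ (s t : VD f) (h : V f), τ (inj f s * h * inj f t) = s * τ h * t) ∧
      -- (1)
      (IsWeaklySeparablePoly f ↔
        Function.Injective (inj f) ∧ Function.Exact (inj f) (derivV f) ∧
          Function.Exact (derivV f) τ) ∧
      -- (2)
      (IsSeparablePoly f ↔
        Function.Injective (inj f) ∧ Function.Exact (inj f) (derivV f) ∧
          Function.Exact (derivV f) τ ∧ Function.Surjective τ) := by
  have H : IsPPolyExtension p e D b (toResidue f) (root f) := isPPolyExtension Fact.out hb hf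
  refine ⟨traceV H, fun h => ?_, fun s v t => by rw [map_mul, map_mul], fun s t h => ?_,
    traceV_mul_mul H, ?_, ?_⟩
  · simp only [coe_traceV, IsPPolyExtension.trace_apply, inducedDerivation_iterate]
  · refine Subtype.ext ?_
    simp only [coe_derivV, Subring.coe_mul]
    exact IsPPolyExtension.commOp_mul_mul (mem_VD.1 s.2).2 (mem_VD.1 t.2).2 h
  · rw [isWeaklySeparablePoly_iff H hf]
    exact ⟨fun h => ⟨inj_injective f, exact_inj_derivV f, h⟩, fun h => h.2.2⟩
  · constructor
    · intro h
      exact ⟨inj_injective f, exact_inj_derivV f, (isWeaklySeparablePoly_iff H hf).1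
        (RingExtension.IsSeparable.isWeaklySeparable h),
        (isSeparablePoly_iff_surjective H hb hf).1 h⟩
    · exact fun h => (isSeparablePoly_iff_surjective H hb hf).2 h.2.2.2
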